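/- Let $L,d,N\ge 1$ and let $d_0,d_1,\dots,d_L$ be widths with $d_L=2d$. For $\ell=1,\dots,L$ let $\alpha_\ell:\mathbb R^{d_\ell}\to\mathbb R^{d_\ell}$ be $\sigma_\ell$-Lipschitz (Euclidean norms) with $\alpha_\ell(0)=0$, let $\rho_\ell>0$, $a_\ell\ge 0$, and let $\Theta_0^\ell\in\mathbb R^{d_\ell\times d_{\ell-1}}$ be fixed reference matrices. Put $$\Xi=\prod_{\ell=1}^L\bigl\{\Theta^\ell\in\mathbb R^{d_\ell\times d_{\ell-1}}:\ \|\Theta^\ell\|_2\le\rho_\ell,\ \|(\Theta^\ell-\Theta_0^\ell)^\top\|_{2,1}\le a_\ell\bigr\},$$ where $\|\cdot\|_2$ is the spectral norm and $\|\cdot\|_{2,1}$ is the sum of the Euclidean norms of the columns, and let $\mathcal F_\Xi=\{f_\Theta:\Theta\in\Xi\}$ with $$f_\Theta(x)=\alpha_L\bigl(\Theta^L\alpha_{L-1}(\Theta^{L-1}\cdots\alpha_1(\Theta^1x))\bigr)=\begin{pmatrix}\mu_\Theta(x)\\ \varepsilon_\Theta(x)\end{pmatrix},\qquad \mu_\Theta(x),\varepsilon_\Theta(x)\in\mathbb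 R^d .$$ The KL regularizer is $$D(f_\Theta;x)=\frac1{2d}\Bigl(\|\mu_\Theta(x)\|_2^2+\|\exp(\varepsilon_\Theta(x))\|_1-d-\langle \mathbf 1_d,\varepsilon_\Theta(x)\rangle\Bigr).$$ Let $\mathcal D$ be a probability distribution on a set $\mathcal X\subseteq\mathbb R^{d_0}$, let $\mathcal T$ be a probability distribution over augmentation maps $t:\mathcal X\to\mathcal X$ (with $(x,t)\mapsto t(x)$ measurable), and assume $B_{x,t}:=\sup_{x\in\mathcal X,\,t}\|t(x)\|_2<\infty$. Let $x_1,\dots,x_N\sim\mathcal D$ and $t_1',\dots,t_N',t_1'',\dots,t_N''\sim\mathcal T$ all be independent, and put $x_i'=t_i'(x_i)$, $x_i''=t_i''(x_i)$. Let $\delta\in(0,1)$, $W=\max_{1\le\ell\le L}d_\ell$ and $\eta=1\vee\exp\bigl(B_{x,t}\prod_{\ell=1}^L\rho_\ell\sigma_\ell\bigr)$. Then $D(f;t(x))$ is integrable under $x\sim\mathcal D$, $t\sim\mathcal T$ for every $f\in\mathcal F_\Xi$, and with probability at least $1-\delta$ $$\sup_{f\in\mathcal F_\Xi}\Bigl[\mathbb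 E_{x\sim\mathcal D,\,t\sim\mathcal T}D(f;t(x))-\frac1{2N}\sum_{i=1}^N\bigl(D(f;x_i')+D(f;x_i'')\bigr)\Bigr] \le C\,(1+\log N)^k\;\frac{\eta\,B_{x,t}\prod_{\ell=1}^L(\rho_\ell\sigma_\ell)}{\sqrt N}\Bigl[\sqrt{\log W}\Bigl(\sum_{\ell=1}^L(a_\ell/\rho_\ell)^{2/3}\Bigr)^{3/2}\vee\sqrt{\log(1/\delta)}\Bigr],$$ where $C>0$ and $k\in\mathbb N$ are absolute constants. -/

import Mathlib

open MeasureTheory ProbabilityTheory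
open scoped NNReal

noncomputable section

namespace VCL

/-- `ℝⁿ` with the Euclidean norm. -/
abbrev Euc (n : ℕ) : Type := EuclideanSpace ℝ (Fin n)

/-- A sequence of weight matrices. The widths are `width 0, width 1, …`; the matrix with index `ℓ`
is the weight of the layer from `ℝ^(width ℓ)` to `ℝ^(width (ℓ + 1))`, so the layers of a network of
depth `L` have the indices `ℓ = 0, …, L - 1`; later entries play no role. -/
abbrev Weights (width : ℕ → ℕ) : Type :=
  (ℓ : ℕ) → Matrix (Fin (width (ℓ + 1))) (Fin (width ℓ)) ℝ

/-- A sequence of activation functions; the one with index `ℓ` is applied to the output of the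
weight matrix with index `ℓ`. -/
abbrev Activations (width : ℕ → ℕ) : Type :=
  (ℓ : ℕ) → Euc (width (ℓ + 1)) → Euc (width (ℓ + 1))

/-- The feed-forward network with the first `L` layers,
`x ↦ α_L (Θ^L α_{L-1} (Θ^{L-1} ⋯ α_1 (Θ^1 x)))`. -/
def network {width : ℕ → ℕ} (act : Activations width) (Θ : Weights width) :
    (L : ℕ) → Euc (width 0) → Euc (width L)
  | 0, x => x
  | L + 1, x => act L (Matrix.toEuclideanLin (Θ L) (network act Θ L x))

/-- The spectral norm of a matrix: the operator norm for the Euclidean norms. -/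
def matrixSpectralNorm {m n : ℕ} (A : Matrix (Fin m) (Fin n) ℝ) : ℝ :=
  ‖(Matrix.toEuclideanLin A).toContinuousLinearMap‖

/-- The norm `‖A‖_{2,1}`: the sum of the Euclidean norms of the columns of `A`. -/
def norm21 {m n : ℕ} (A : Matrix (Fin m) (Fin n) ℝ) : ℝ :=
  ∑ j : Fin n, ‖(WithLp.toLp 2 (fun i => A i j) : Euc m)‖

/-- The set `Ξ = ∏ Ξ_ℓ` of admissible weights: for every layer, the spectral norm of `Θ^ℓ` is at
most `ρ_ℓ` and `‖(Θ^ℓ - Θ₀^ℓ)ᵀ‖_{2,1}` is at most `a_ℓ`. -/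
def weightSet {width : ℕ → ℕ} (L : ℕ) (ρ a : ℕ → ℝ) (Θ₀ : Weights width) : Set (Weights width) :=
  {Θ | ∀ ℓ < L, matrixSpectralNorm (Θ ℓ) ≤ ρ ℓ ∧ norm21 (Θ ℓ - Θ₀ ℓ).transpose ≤ a ℓ}

/-- The class `{f_Θ : Θ ∈ Ξ}` of encoders of depth `L`. -/
def networkClass {width : ℕ → ℕ} (L : ℕ) (act : Activations width) (ρ a : ℕ → ℝ)
    (Θ₀ : Weights width) : Set (Euc (width 0) → Euc (width L)) :=
  {f | ∃ Θ ∈ weightSet L ρ a Θ₀, f = network act Θ L}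

/-- The first half `μ` of an encoder output `(μ, ε) ∈ ℝ^(2d)`. -/
def meanPart {m d : ℕ} (h : m = 2 * d) (v : Euc m) : Euc d :=
  WithLp.toLp 2 (fun j : Fin d => v ⟨j, by omega⟩)

/-- The second half `ε` of an encoder output `(μ, ε) ∈ ℝ^(2d)`. -/
def logVarPart {m d : ℕ} (h : m = 2 * d) (v : Euc m) : Euc d :=
  WithLp.toLp 2 (fun j : Fin d => v ⟨d + j, by omega⟩)

/-- The KL regularizer of an encoder output `v = (μ, ε)`:
`(1 / 2d) (‖μ‖² + ‖exp ε‖₁ - d - ⟨1, ε⟩)`. -/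
def klReg {m d : ℕ} (h : m = 2 * d) (v : Euc m) : ℝ :=
  1 / (2 * (d : ℝ)) *
    (‖meanPart h v‖ ^ 2 + ∑ j : Fin d, |Real.exp (logVarPart h v j)| - (d : ℝ)
      - ∑ j : Fin d, logVarPart h v j)

/-- `B_{x,t} = sup ‖t(x)‖` over all inputs `x` and all augmentations `t`; the augmentation maps are
`aug t : 𝒳 → 𝒳` for `t : T`. -/
def augRadius {n : ℕ} {𝒳 : Set (Euc n)} {T : Type*} (aug : T → 𝒳 → 𝒳) : ℝ :=
  ⨆ p : 𝒳 × T, ‖(aug p.2 p.1 : Euc n)‖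

/-- The largest width `W` among the layers `1, …, L` (the input dimension is not included). -/
def maxWidth (L : ℕ) (width : ℕ → ℕ) : ℕ :=
  (Finset.Icc 1 L).sup width

/-- The product of `ρ_ℓ σ_ℓ` over all layers. -/
def lipProd (L : ℕ) (ρ : ℕ → ℝ) (σ : ℕ → ℝ≥0) : ℝ :=
  ∏ ℓ ∈ Finset.range L, ρ ℓ * (σ ℓ : ℝ)

/-- The rate, without logarithmic factors in `N` and absolute constants:
`η B ∏ (ρ_ℓ σ_ℓ) / √N * [√(log W) (∑ (a_ℓ / ρ_ℓ)^(2/3))^(3/2) ∨ √(log (1/δ))]` with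
`η = 1 ∨ exp (B ∏ ρ_ℓ σ_ℓ)`. -/
def genRate (L N : ℕ) (width : ℕ → ℕ) (ρ a : ℕ → ℝ) (σ : ℕ → ℝ≥0) (B δ : ℝ) : ℝ :=
  max 1 (Real.exp (B * lipProd L ρ σ)) * B * lipProd L ρ σ / Real.sqrt N *
    max (Real.sqrt (Real.log (maxWidth L width)) *
        (∑ ℓ ∈ Finset.range L, (a ℓ / ρ ℓ) ^ (2 / 3 : ℝ)) ^ (3 / 2 : ℝ))
      (Real.sqrt (Real.log (1 / δ)))

end VCL

end

/-! A triple `(x, t', t'')` counts as one sample, and the loss of a network on it is the mean of the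
regularizer at the two augmented points; thus there are `N` independent samples. Put `R = B ∏ ρ_ℓ
σ_ℓ`. All outputs lie in the ball of radius `R`, where the regularizer is `2 exp R`-Lipschitz; since
it vanishes at `0`, it is bounded there by `2 R exp R`.

For a finite set of networks, McDiarmid's inequality replaces the largest deviation by its
expectation, and symmetrization bounds the expectation by a Rademacher complexity
(`measureReal_finite_class_deviation_le`). A dense sequence of weights and continuity extend this to
the whole class.

The complexity is bounded through metric entropy. In one layer, the images of the data under the
deviations from the reference matrix lie in the convex hull of few atoms, and Maurey's method
approximates a point of the hull by an average of `k` atoms (`exists_cover_linear`). The data span a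
space of dimension at most their number, so the input dimension is absent. Layers are composed by
covering each one at the centres found for the previous ones; centres are taken from the admissible
set, which keeps their norms under control. Sharing the resolution among the layers in proportion to
`(a_ℓ/ρ_ℓ)^(2/3)` gives entropy of order `1/ε²` with the cube of the sum as a factor
(`exists_cover_network`).

For such entropy every dyadic scale contributes equally to Dudley's chaining, and about `log₂ N`
scales suffice (`rademacher_le_of_entropy`); this loses only logarithms of `N`. -/

noncomputable section

namespace VCL

/-! ### McDiarmid's inequality -/

/-- The moment generating function bound behind McDiarmid's inequality. -/
theorem integral_exp_le_of_bounded_differences {Z : Type*} [MeasurableSpace Z] (μ : Measure Z)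
    [IsProbabilityMeasure μ] (c t K : ℝ) :
    ∀ (n : ℕ) (F : (Fin n → Z) → ℝ), Measurable F → (∀ z, |F z| ≤ K) →
      (∀ z i w, |F (Function.update z i w) - F z| ≤ c) →
      ∫ z, Real.exp (t * F z) ∂(Measure.pi fun _ => μ)
        ≤ Real.exp (t * ∫ z, F z ∂(Measure.pi fun _ => μ) + n * (c ^ 2 * t ^ 2 / 8)) := by
  have hbdd : ∀ {Y : Type _} [MeasurableSpace Y] (ν : Measure Y) [IsProbabilityMeasure ν]
      (f : Y → ℝ) (B : ℝ), Measurable f → (∀ y, |f y| ≤ B) → Integrable f ν :=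
    fun ν _ f B hf hB => Integrable.of_bound hf.aestronglyMeasurable B (Filter.Eventually.of_forall hB)
  have hexp : ∀ {Y : Type _} [MeasurableSpace Y] (ν : Measure Y) [IsProbabilityMeasure ν]
      (f : Y → ℝ), Measurable f → (∀ y, |f y| ≤ K) →
      Integrable (fun y => Real.exp (t * f y)) ν := by
    intro Y _ ν _ f hf hB
    refine hbdd ν _ (Real.exp (|t| * K)) (by fun_prop) fun y => ?_
    rw [abs_of_pos (Real.exp_pos _)]
    refine Real.exp_le_exp.2 ((le_abs_self _).trans ?_)
    rw [abs_mul]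
    exact mul_le_mul_of_nonneg_left (hB y) (abs_nonneg _)
  intro n
  induction n with
  | zero =>
    intro F _ _ _
    have hF : ∀ z, F z = F default := fun z => by rw [Subsingleton.elim z default]
    simp [hF]
  | succ n ih =>
    intro F hF hK hd
    set ν : Measure (Fin n → Z) := Measure.pi fun _ => μ with hν
    have hmp := (measurePreserving_piFinSuccAbove (fun _ : Fin (n + 1) => μ) 0).symm
    have hsymm : ∀ p : Z × (Fin n → Z),
        (MeasurableEquiv.piFinSuccAbove (fun _ : Fin (n + 1) => Z) 0).symm p
          = (Fin.cons p.1 p.2 : Fin (n + 1) → Z) := fun p => Fin.insertNth_zero' p.1 p.2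
    have hchange : ∀ g : (Fin (n + 1) → Z) → ℝ, ∫ z, g z ∂(Measure.pi fun _ => μ)
        = ∫ p : Z × (Fin n → Z), g (Fin.cons p.1 p.2) ∂(μ.prod ν) := by
      intro g
      rw [← hmp.integral_comp' g]
      simp only [hsymm]
      rfl
    have hcons : Measurable fun p : Z × (Fin n → Z) => (Fin.cons p.1 p.2 : Fin (n + 1) → Z) := by
      have := hmp.measurable
      rwa [funext hsymm] at this
    have hFc : Measurable fun p : Z × (Fin n → Z) => F (Fin.cons p.1 p.2) := hF.comp hcons
    have hFz : ∀ z : Fin n → Z, Measurable fun a => F (Fin.cons a z) := fun z =>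
      hFc.comp (measurable_id.prodMk measurable_const)
    -- Integrating out coordinate `0` preserves bounded differences with the same `c`, so the
    -- induction hypothesis applies to `G`.
    set G : (Fin n → Z) → ℝ := fun z => ∫ a, F (Fin.cons a z) ∂μ with hG
    have hGm : Measurable G := by
      have h : StronglyMeasurable (Function.uncurry fun (z : Fin n → Z) (a : Z) => F (Fin.cons a z)) :=
        (hFc.comp (measurable_snd.prodMk measurable_fst)).stronglyMeasurable
      exact h.integral_prod_right.measurable
    have hGK : ∀ z, |G z| ≤ K := fun z => by
      have := norm_integral_le_of_norm_le_const (μ := μ) (f := fun a => F (Fin.cons a z)) (C := K)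
        (Filter.Eventually.of_forall fun a => hK _)
      simpa using this
    have hGd : ∀ z i w, |G (Function.update z i w) - G z| ≤ c := by
      intro z i w
      simp only [hG]
      rw [← integral_sub (hbdd _ _ K (hFz _) fun _ => hK _) (hbdd _ _ K (hFz _) fun _ => hK _)]
      have := norm_integral_le_of_norm_le_const (μ := μ)
        (f := fun a => F (Fin.cons a (Function.update z i w)) - F (Fin.cons a z)) (C := c)
        (Filter.Eventually.of_forall fun a => by
          rw [Fin.cons_update]
          exact hd _ _ _)
      simpa using this
    -- Hoeffding's lemma in coordinate `0`: with the others fixed, the values lie in an interval of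
    -- length `c` that starts at their infimum.
    have hstep : ∀ z, ∫ a, Real.exp (t * F (Fin.cons a z)) ∂μ
        ≤ Real.exp (t * G z + c ^ 2 * t ^ 2 / 8) := by
      intro z
      have hbb : BddBelow (Set.range fun a => F (Fin.cons a z)) :=
        ⟨-K, by rintro _ ⟨a, rfl⟩; exact (abs_le.1 (hK _)).1⟩
      have hne : Nonempty Z := nonempty_of_isProbabilityMeasure μ
      set m := ⨅ a, F (Fin.cons a z)
      have hup : ∀ a, F (Fin.cons a z) ≤ m + c := by
        intro a
        have : F (Fin.cons a z) - c ≤ m := le_ciInf fun b => by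
          have := hd (Fin.cons b z) 0 a
          rw [Fin.update_cons_zero] at this
          linarith [(abs_le.1 this).2]
        linarith
      have hs := hasSubgaussianMGF_of_mem_Icc (μ := μ) (X := fun a => F (Fin.cons a z)) (a := m)
        (b := m + c) (hFz z).aemeasurable
        (Filter.Eventually.of_forall fun a => ⟨ciInf_le hbb a, hup a⟩)
      have h2 := hs.mgf_le t
      have h3 : mgf (fun a => F (Fin.cons a z) - ∫ a, F (Fin.cons a z) ∂μ) μ t
          = Real.exp (- (t * G z)) * ∫ a, Real.exp (t * F (Fin.cons a z)) ∂μ := by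
        rw [mgf, ← integral_const_mul]
        refine integral_congr_ae (Filter.Eventually.of_forall fun a => ?_)
        simp only [hG]
        rw [← Real.exp_add]
        ring_nf
      rw [h3] at h2
      have h4 : ((((‖m + c - m‖₊ / 2) ^ 2 : ℝ≥0) : ℝ) * t ^ 2 / 2) = c ^ 2 * t ^ 2 / 8 := by
        push_cast
        rw [add_sub_cancel_left, Real.norm_eq_abs, div_pow, sq_abs]
        ring
      rw [h4] at h2
      rw [Real.exp_add]
      calc _ = Real.exp (t * G z) * (Real.exp (- (t * G z)) * ∫ a, Real.exp (t * F (Fin.cons a z)) ∂μ) := by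
            rw [← mul_assoc, ← Real.exp_add]; simp
        _ ≤ _ := mul_le_mul_of_nonneg_left h2 (Real.exp_pos _).le
    rw [hchange, hchange,
      integral_prod_symm _ (hexp (μ.prod ν) (fun p => F (Fin.cons p.1 p.2)) hFc fun _ => hK _),
      integral_prod_symm _ (hbdd (μ.prod ν) (fun p => F (Fin.cons p.1 p.2)) K hFc fun _ => hK _)]
    calc ∫ z, ∫ a, Real.exp (t * F (Fin.cons a z)) ∂μ ∂ν
        ≤ ∫ z, Real.exp (c ^ 2 * t ^ 2 / 8) * Real.exp (t * G z) ∂ν := by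
          refine integral_mono (hexp (μ.prod ν) (fun p => F (Fin.cons p.1 p.2)) hFc fun _ => hK _).integral_prod_right
            ((hexp ν G hGm hGK).const_mul _) fun z => ?_
          refine (hstep z).trans (le_of_eq ?_)
          rw [← Real.exp_add, add_comm]
      _ = Real.exp (c ^ 2 * t ^ 2 / 8) * ∫ z, Real.exp (t * G z) ∂ν := integral_const_mul _ _
      _ ≤ Real.exp (c ^ 2 * t ^ 2 / 8) * Real.exp (t * ∫ z, G z ∂ν + n * (c ^ 2 * t ^ 2 / 8)) :=
          mul_le_mul_of_nonneg_left (ih G hGm hGK hGd) (Real.exp_pos _).le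
      _ = _ := by
          rw [← Real.exp_add]
          push_cast
          congr 1
          ring

/-- **McDiarmid's inequality**, as a one-sided confidence bound. -/
theorem measureReal_le_add_of_bounded_differences {Z : Type*} [MeasurableSpace Z] (μ : Measure Z)
    [IsProbabilityMeasure μ] {c K δ : ℝ} (hc : 0 < c) (hδ : 0 < δ) (hδ1 : δ < 1) {n : ℕ} (hn : 1 ≤ n)
    (F : (Fin n → Z) → ℝ) (hF : Measurable F) (hK : ∀ z, |F z| ≤ K)
    (hd : ∀ z i w, |F (Function.update z i w) - F z| ≤ c) :
    1 - δ ≤ (Measure.pi fun _ : Fin n => μ).real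
      {z | F z ≤ (∫ z, F z ∂(Measure.pi fun _ => μ)) + c * Real.sqrt (n * Real.log (1 / δ) / 2)} := by
  set ν := (Measure.pi fun _ : Fin n => μ)
  set m := ∫ z, F z ∂ν
  set s := c * Real.sqrt (n * Real.log (1 / δ) / 2)
  have hn' : (0 : ℝ) < n := by exact_mod_cast hn
  have hlog : 0 ≤ Real.log (1 / δ) := Real.log_nonneg (by rw [le_div_iff₀ hδ]; linarith)
  obtain ⟨v, hv⟩ : ∃ v : ℝ≥0, (v : ℝ) = n * c ^ 2 / 4 := ⟨⟨n * c ^ 2 / 4, by positivity⟩, rfl⟩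
  have hsub : HasSubgaussianMGF (fun z => F z - m) v ν := by
    refine ⟨fun t => ?_, fun t => ?_⟩
    · refine Integrable.of_bound (by fun_prop) (Real.exp (|t| * (K + |m|)))
        (Filter.Eventually.of_forall fun z => ?_)
      rw [Real.norm_eq_abs, abs_of_pos (Real.exp_pos _)]
      refine Real.exp_le_exp.2 ((le_abs_self _).trans ?_)
      rw [abs_mul]
      exact mul_le_mul_of_nonneg_left ((abs_sub _ _).trans (by linarith [hK z])) (abs_nonneg _)
    · have h := integral_exp_le_of_bounded_differences μ c t K n F hF hK hd
      have h3 : mgf (fun z => F z - m) ν t = Real.exp (- (t * m)) * ∫ z, Real.exp (t * F z) ∂ν := by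
        rw [mgf, ← integral_const_mul]
        refine integral_congr_ae (Filter.Eventually.of_forall fun a => ?_)
        simp only
        rw [← Real.exp_add]
        ring_nf
      rw [h3]
      refine (mul_le_mul_of_nonneg_left h (Real.exp_pos _).le).trans ?_
      rw [← Real.exp_add]
      refine Real.exp_le_exp.2 (le_of_eq ?_)
      rw [hv]
      ring
  have hs : 0 ≤ s := by positivity
  have htail := hsub.measure_ge_le hs
  -- The deviation `s` is the one at which the sub-Gaussian tail with variance proxy `n c² / 4`
  -- equals `δ`.
  have hval : Real.exp (-s ^ 2 / (2 * (v : ℝ))) = δ := by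
    rw [hv, mul_pow, Real.sq_sqrt (by positivity)]
    have : -(c ^ 2 * (n * Real.log (1 / δ) / 2)) / (2 * (n * c ^ 2 / 4)) = Real.log δ := by
      rw [one_div, Real.log_inv]
      field_simp
      ring
    rw [this, Real.exp_log hδ]
  rw [hval] at htail
  have hms : MeasurableSet {z | s ≤ F z - m} := measurableSet_le measurable_const (by fun_prop)
  have hcompl := probReal_compl_eq_one_sub (μ := ν) hms
  calc 1 - δ ≤ ν.real {z | s ≤ F z - m}ᶜ := by rw [hcompl]; linarith
    _ ≤ _ := measureReal_mono fun z hz => by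
        simp only [Set.mem_compl_iff, Set.mem_ofPred_eq, not_le] at hz ⊢
        linarith

/-! ### Rademacher averages and symmetrization -/

/-- The sign `±1` attached to a Boolean. -/
def boolSign (b : Bool) : ℝ := if b then 1 else -1

theorem abs_boolSign (b : Bool) : |boolSign b| = 1 := by cases b <;> simp [boolSign]

theorem boolSign_not (b : Bool) : boolSign (!b) = -boolSign b := by cases b <;> simp [boolSign]

/-- The (unnormalized) empirical Rademacher complexity of a family of vectors in `ℝⁿ`. -/
def rademacher {κ : Type*} {n : ℕ} (v : κ → Fin n → ℝ) : ℝ :=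
  (2 ^ n)⁻¹ * ∑ s : Fin n → Bool, ⨆ k, ∑ i, boolSign (s i) * v k i

theorem le_ciSup_finite {κ : Type*} [Finite κ] (f : κ → ℝ) (k : κ) : f k ≤ ⨆ k, f k :=
  le_ciSup (Set.finite_range f).bddAbove k

theorem abs_ciSup_le {κ : Type*} [Finite κ] [Nonempty κ] {f : κ → ℝ} {c : ℝ}
    (h : ∀ k, |f k| ≤ c) : |⨆ k, f k| ≤ c := by
  obtain ⟨k⟩ := ‹Nonempty κ›
  exact abs_le.2 ⟨(abs_le.1 (h k)).1.trans (le_ciSup_finite f k),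
    ciSup_le fun k => (abs_le.1 (h k)).2⟩

theorem ciSup_add_le {κ : Type*} [Finite κ] [Nonempty κ] (f g : κ → ℝ) :
    ⨆ k, (f k + g k) ≤ (⨆ k, f k) + ⨆ k, g k :=
  ciSup_le fun k => add_le_add (le_ciSup_finite f k) (le_ciSup_finite g k)

theorem rademacher_add_le {κ : Type*} [Finite κ] [Nonempty κ] {n : ℕ} (v w : κ → Fin n → ℝ) :
    rademacher (fun k i => v k i + w k i) ≤ rademacher v + rademacher w := by
  unfold rademacher
  rw [← mul_add, ← Finset.sum_add_distrib]
  refine mul_le_mul_of_nonneg_left (Finset.sum_le_sum fun s _ => ?_) (by positivity)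
  simp only [mul_add, Finset.sum_add_distrib]
  exact ciSup_add_le _ _

theorem rademacher_neg {κ : Type*} {n : ℕ} (v : κ → Fin n → ℝ) :
    rademacher (fun k i => -v k i) = rademacher v := by
  unfold rademacher
  congr 1
  refine Fintype.sum_equiv (Equiv.piCongrRight fun _ => Equiv.boolNot) _ _ fun s => ?_
  refine iSup_congr fun k => Finset.sum_congr rfl fun i _ => ?_
  simp [boolSign_not]

theorem abs_sum_fin_le {n : ℕ} {f : Fin n → ℝ} {c : ℝ} (h : ∀ i, |f i| ≤ c) :
    |∑ i, f i| ≤ n * c := by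
  refine (Finset.abs_sum_le_sum_abs _ _).trans ((Finset.sum_le_sum fun i _ => h i).trans ?_)
  simp

/-- The two members of each pair are exchangeable, independently over the pairs. This invariance is
what allows random signs to be inserted in the symmetrization. -/
theorem measurePreserving_cond_swap {Z : Type*} [MeasurableSpace Z] (μ : Measure Z)
    [IsProbabilityMeasure μ] {n : ℕ} (s : Fin n → Bool) :
    MeasurePreserving (fun (w : Fin n → Z × Z) i => if s i then w i else (w i).swap)
      (Measure.pi fun _ => μ.prod μ) (Measure.pi fun _ => μ.prod μ) := by
  have h1 : ∀ i, MeasurePreserving (fun p : Z × Z => if s i then p else p.swap)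
      (μ.prod μ) (μ.prod μ) := by
    intro i
    cases s i
    · simpa using Measure.measurePreserving_swap
    · exact MeasurePreserving.id _
  have : ∀ i, SigmaFinite ((μ.prod μ).map fun p : Z × Z => if s i then p else p.swap) := fun i => by
    rw [(h1 i).map_eq]; infer_instance
  refine ⟨by
    refine measurable_pi_lambda _ fun i => ?_
    exact (h1 i).measurable.comp (measurable_pi_apply i), ?_⟩
  have h2 := Measure.pi_map_pi (μ := fun _ : Fin n => μ.prod μ)
    (f := fun i (p : Z × Z) => if s i then p else p.swap) fun i => (h1 i).measurable.aemeasurable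
  rw [h2]
  congr 1
  funext i
  exact (h1 i).map_eq

/-- **Symmetrization** for a finite class of bounded functions. -/
theorem integral_iSup_deviation_le {Z κ : Type*} [MeasurableSpace Z] (μ : Measure Z)
    [IsProbabilityMeasure μ] [Finite κ] [Nonempty κ] {n : ℕ} (g : κ → Z → ℝ)
    (hg : ∀ k, Measurable (g k)) {M R : ℝ} (hM : ∀ k z, |g k z| ≤ M)
    (hR : ∀ z : Fin n → Z, rademacher (fun k i => g k (z i)) ≤ R) :
    ∫ z : Fin n → Z, (⨆ k, ∑ i, ((∫ y, g k y ∂μ) - g k (z i))) ∂(Measure.pi fun _ => μ)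
      ≤ 2 * R := by
  set ν : Measure (Fin n → Z) := Measure.pi fun _ => μ with hν
  have hpair : ∀ k z z', |g k z' - g k z| ≤ 2 * M := fun k z z' =>
    (abs_sub _ _).trans (by linarith [hM k z, hM k z'])
  set Φ : (Fin n → Bool) → (Fin n → Z × Z) → ℝ := fun s w =>
    ⨆ k, ∑ i, boolSign (s i) * (g k (w i).2 - g k (w i).1) with hΦ
  have hΦm : ∀ s, Measurable (Φ s) := fun s => Measurable.iSup fun k => by
    refine Finset.measurable_sum _ fun i _ => Measurable.const_mul (Measurable.sub ?_ ?_) _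
    · exact (hg k).comp (measurable_snd.comp (measurable_pi_apply i))
    · exact (hg k).comp (measurable_fst.comp (measurable_pi_apply i))
  have hΦb : ∀ s w, |Φ s w| ≤ n * (2 * M) := fun s w => abs_ciSup_le fun k =>
    abs_sum_fin_le fun i => by rw [abs_mul, abs_boolSign, one_mul]; exact hpair _ _ _
  have hΦi : ∀ s, Integrable (Φ s) (Measure.pi fun _ => μ.prod μ) := fun s =>
    Integrable.of_bound (hΦm s).aestronglyMeasurable _ (Filter.Eventually.of_forall (hΦb s))
  set Ψ : (Fin n → Z) × (Fin n → Z) → ℝ := fun p => ⨆ k, ∑ i, (g k (p.2 i) - g k (p.1 i)) with hΨ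
  have hΨm : Measurable Ψ := Measurable.iSup fun k => by
    refine Finset.measurable_sum _ fun i _ => Measurable.sub ?_ ?_
    · exact (hg k).comp ((measurable_pi_apply i).comp measurable_snd)
    · exact (hg k).comp ((measurable_pi_apply i).comp measurable_fst)
  have hΨb : ∀ p, |Ψ p| ≤ n * (2 * M) := fun p => abs_ciSup_le fun k =>
    abs_sum_fin_le fun i => hpair _ _ _
  have hΨi : Integrable Ψ (ν.prod ν) :=
    Integrable.of_bound hΨm.aestronglyMeasurable _ (Filter.Eventually.of_forall hΨb)
  have hΨz : ∀ z, Integrable (fun z' => Ψ (z, z')) ν := fun z =>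
    Integrable.of_bound (hΨm.comp measurable_prodMk_left).aestronglyMeasurable _
      (Filter.Eventually.of_forall fun z' => hΨb _)
  have hcoord : ∀ k i, Integrable (fun z' : Fin n → Z => g k (z' i)) ν := fun k i =>
    Integrable.of_bound ((hg k).comp (measurable_pi_apply i)).aestronglyMeasurable M
      (Filter.Eventually.of_forall fun z' => hM _ _)
  -- Ghost sample: the mean is an average over an independent copy `z'`, and a supremum of averages
  -- is at most the average of the suprema.
  have hghost : ∀ z : Fin n → Z,
      (⨆ k, ∑ i, ((∫ y, g k y ∂μ) - g k (z i))) ≤ ∫ z', Ψ (z, z') ∂ν := by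
    intro z
    refine ciSup_le fun k => ?_
    have h1 : ∑ i, ((∫ y, g k y ∂μ) - g k (z i)) = ∫ z', ∑ i, (g k (z' i) - g k (z i)) ∂ν := by
      have hi : ∀ i ∈ Finset.univ, Integrable (fun z' : Fin n → Z => g k (z' i) - g k (z i)) ν :=
        fun i _ => (hcoord k i).sub (integrable_const _)
      rw [integral_finsetSum _ hi]
      refine Finset.sum_congr rfl fun i _ => ?_
      rw [integral_sub (hcoord k i) (integrable_const _)]
      have := (measurePreserving_eval (fun _ : Fin n => μ) i).map_eq
      have h2 : ∫ y, g k y ∂μ = ∫ z' : Fin n → Z, g k (z' i) ∂ν := by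
        conv_lhs => rw [← this]
        rw [integral_map (measurable_pi_apply i).aemeasurable (hg k).aestronglyMeasurable]
      rw [h2]
      simp
    rw [h1]
    exact integral_mono (integrable_finsetSum _ fun i _ => (hcoord k i).sub (integrable_const _))
      (hΨz z) fun z' => le_ciSup_finite (fun k => ∑ i, (g k (z' i) - g k (z i))) k
  have hH : ∫ z : Fin n → Z, (⨆ k, ∑ i, ((∫ y, g k y ∂μ) - g k (z i))) ∂ν
      ≤ ∫ w, Φ (fun _ => true) w ∂(Measure.pi fun _ => μ.prod μ) := by
    have hHm : Measurable fun z : Fin n → Z => ⨆ k, ∑ i, ((∫ y, g k y ∂μ) - g k (z i)) :=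
      Measurable.iSup fun k => Finset.measurable_sum _ fun i _ =>
        measurable_const.sub ((hg k).comp (measurable_pi_apply i))
    have hgk : ∀ k, |∫ y, g k y ∂μ| ≤ M := fun k => by
      simpa using norm_integral_le_of_norm_le_const (μ := μ) (f := g k) (C := M) (Filter.Eventually.of_forall (hM k))
    calc _ ≤ ∫ z, ∫ z', Ψ (z, z') ∂ν ∂ν := by
          refine integral_mono (Integrable.of_bound hHm.aestronglyMeasurable (n * (2 * M))
            (Filter.Eventually.of_forall fun z => ?_)) hΨi.integral_prod_left hghost
          exact abs_ciSup_le fun k => abs_sum_fin_le fun i =>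
            (abs_sub _ _).trans (by linarith [hM k (z i), hgk k])
      _ = ∫ p, Ψ p ∂(ν.prod ν) := (integral_prod _ hΨi).symm
      _ = _ := by
          rw [← (measurePreserving_arrowProdEquivProdArrow Z Z (Fin n) (fun _ => μ)
            (fun _ => μ)).integral_comp']
          simp only [hΦ, hΨ, boolSign, if_true, one_mul]
          rfl
  -- Swapping pair `i` flips the sign of term `i`, so all sign patterns have the same integral and
  -- one may average over them.
  have hswap : ∀ s, ∫ w, Φ (fun _ => true) w ∂(Measure.pi fun _ => μ.prod μ)
      = ∫ w, Φ s w ∂(Measure.pi fun _ => μ.prod μ) := by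
    intro s
    have hmp := measurePreserving_cond_swap μ s
    conv_lhs => rw [← hmp.map_eq]
    rw [integral_map hmp.measurable.aemeasurable (hΦm _).aestronglyMeasurable]
    refine integral_congr_ae (Filter.Eventually.of_forall fun w => ?_)
    simp only [hΦ]
    refine iSup_congr fun k => Finset.sum_congr rfl fun i _ => ?_
    cases s i <;> simp [boolSign]
  have hcard : ((Fintype.card (Fin n → Bool) : ℕ) : ℝ) = 2 ^ n := by simp
  calc _ ≤ ∫ w, Φ (fun _ => true) w ∂(Measure.pi fun _ => μ.prod μ) := hH
    _ = (2 ^ n)⁻¹ * ∑ s : Fin n → Bool, ∫ w, Φ s w ∂(Measure.pi fun _ => μ.prod μ) := by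
        rw [← Finset.sum_congr rfl fun s _ => hswap s, Finset.sum_const, Finset.card_univ,
          nsmul_eq_mul, hcard, inv_mul_cancel_left₀ (by positivity)]
    _ = ∫ w, (2 ^ n)⁻¹ * ∑ s : Fin n → Bool, Φ s w ∂(Measure.pi fun _ => μ.prod μ) := by
        rw [integral_const_mul, integral_finsetSum _ fun s _ => hΦi s]
    _ ≤ ∫ _w : Fin n → Z × Z, 2 * R ∂(Measure.pi fun _ => μ.prod μ) := by
        refine integral_mono ((integrable_finsetSum _ fun s _ => hΦi s).const_mul _)
          (integrable_const _) fun w => ?_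
        have h := rademacher_add_le (fun k i => g k (w i).2) (fun k i => -g k (w i).1)
        rw [rademacher_neg] at h
        have h1 := hR fun i => (w i).2
        have h2 := hR fun i => (w i).1
        simp only [← sub_eq_add_neg] at h
        have h3 : (2 ^ n)⁻¹ * ∑ s : Fin n → Bool, Φ s w
          = rademacher (fun k i => g k (w i).2 - g k (w i).1) := rfl
        show (2 ^ n)⁻¹ * ∑ s : Fin n → Bool, Φ s w ≤ 2 * R
        linarith
    _ = 2 * R := by simp

/-! ### Massart's lemma and Dudley's chaining -/

/-- The average over the signs factors into a product of `cosh (u i)`, and `cosh x ≤ exp (x² / 2)`.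
-/
theorem sum_exp_boolSign_le {n : ℕ} (u : Fin n → ℝ) :
    (2 ^ n)⁻¹ * ∑ s : Fin n → Bool, Real.exp (∑ i, boolSign (s i) * u i)
      ≤ Real.exp ((∑ i, u i ^ 2) / 2) := by
  have h1 : ∑ s : Fin n → Bool, Real.exp (∑ i, boolSign (s i) * u i)
      = ∏ i, ∑ b : Bool, Real.exp (boolSign b * u i) := by
    rw [Finset.prod_univ_sum, Fintype.piFinset_univ]
    exact Finset.sum_congr rfl fun s _ => Real.exp_sum _ _
  have h2 : (2 ^ n : ℝ)⁻¹ = ∏ _i : Fin n, (2 : ℝ)⁻¹ := by simp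
  rw [h1, h2, ← Finset.prod_mul_distrib, Finset.sum_div, Real.exp_sum]
  refine Finset.prod_le_prod (fun i _ => by positivity) fun i _ => ?_
  refine le_trans (le_of_eq ?_) (Real.cosh_le_exp_half_sq (u i))
  rw [Real.cosh_eq, Fintype.sum_bool]
  simp only [boolSign, if_true, Bool.false_eq_true, if_false]
  ring_nf

/-- **Massart's finite class lemma**, before optimizing over the temperature `t`. -/
theorem rademacher_le_of_mem_finset {κ : Type*} [Finite κ] [Nonempty κ] {n : ℕ}
    (v : κ → Fin n → ℝ) (T : Finset (Fin n → ℝ)) (hT : ∀ k, v k ∈ T) {r ℓ t : ℝ}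
    (hv : ∀ k, ∑ i, v k i ^ 2 ≤ r ^ 2) (hℓ : Real.log T.card ≤ ℓ) (ht : 0 < t) :
    rademacher v ≤ ℓ / t + t * r ^ 2 / 2 := by
  classical
  have := Fintype.ofFinite κ
  -- The norm bound is known only for the vectors that are attained, so the sum runs over these; `T`
  -- serves only to count them.
  set T' := Finset.univ.image v
  have hT' : T' ⊆ T := by
    intro x hx
    obtain ⟨k, -, rfl⟩ := Finset.mem_image.1 hx
    exact hT k
  have hpos : 0 < T.card := Finset.card_pos.2 ⟨_, hT (Classical.arbitrary κ)⟩
  set c := ℓ + t ^ 2 * r ^ 2 / 2 with hc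
  have hmgf : (2 ^ n)⁻¹ * ∑ s : Fin n → Bool,
      Real.exp (t * (⨆ k, ∑ i, boolSign (s i) * v k i) - c) ≤ 1 := by
    have h1 : ∀ s : Fin n → Bool, Real.exp (t * (⨆ k, ∑ i, boolSign (s i) * v k i) - c)
        ≤ Real.exp (-c) * ∑ u ∈ T', Real.exp (∑ i, boolSign (s i) * (t * u i)) := by
      intro s
      obtain ⟨k, hk⟩ := exists_eq_ciSup_of_finite (f := fun k => ∑ i, boolSign (s i) * v k i)
      rw [← hk, sub_eq_neg_add, Real.exp_add]
      refine mul_le_mul_of_nonneg_left ?_ (Real.exp_pos _).le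
      have h2 : t * ∑ i, boolSign (s i) * v k i = ∑ i, boolSign (s i) * (t * v k i) := by
        rw [Finset.mul_sum]
        exact Finset.sum_congr rfl fun i _ => by ring
      rw [h2]
      exact Finset.single_le_sum (f := fun u : Fin n → ℝ => Real.exp (∑ i, boolSign (s i) * (t * u i)))
        (fun _ _ => (Real.exp_pos _).le) (Finset.mem_image_of_mem v (Finset.mem_univ k))
    have h3 : ∀ u ∈ T', (2 ^ n)⁻¹ * ∑ s : Fin n → Bool,
        Real.exp (∑ i, boolSign (s i) * (t * u i)) ≤ Real.exp (t ^ 2 * r ^ 2 / 2) := by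
      intro u hu
      obtain ⟨k, -, rfl⟩ := Finset.mem_image.1 hu
      refine (sum_exp_boolSign_le _).trans (Real.exp_le_exp.2 ?_)
      simp only [mul_pow, ← Finset.mul_sum]
      have := mul_le_mul_of_nonneg_left (hv k) (sq_nonneg t)
      linarith
    calc _ ≤ (2 ^ n)⁻¹ * ∑ s : Fin n → Bool,
          Real.exp (-c) * ∑ u ∈ T', Real.exp (∑ i, boolSign (s i) * (t * u i)) :=
          mul_le_mul_of_nonneg_left (Finset.sum_le_sum fun s _ => h1 s) (by positivity)
      _ = Real.exp (-c) * ∑ u ∈ T', (2 ^ n)⁻¹ * ∑ s : Fin n → Bool,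
            Real.exp (∑ i, boolSign (s i) * (t * u i)) := by
          rw [← Finset.mul_sum, Finset.sum_comm, ← Finset.mul_sum]
          ring
      _ ≤ Real.exp (-c) * ∑ _u ∈ T', Real.exp (t ^ 2 * r ^ 2 / 2) :=
          mul_le_mul_of_nonneg_left (Finset.sum_le_sum h3) (Real.exp_pos _).le
      _ = Real.exp (-c) * (T'.card * Real.exp (t ^ 2 * r ^ 2 / 2)) := by
          rw [Finset.sum_const, nsmul_eq_mul]
      _ ≤ Real.exp (-c) * (Real.exp ℓ * Real.exp (t ^ 2 * r ^ 2 / 2)) := by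
          gcongr
          calc (T'.card : ℝ) ≤ T.card := by exact_mod_cast Finset.card_le_card hT'
            _ = Real.exp (Real.log T.card) := (Real.exp_log (by exact_mod_cast hpos)).symm
            _ ≤ Real.exp ℓ := Real.exp_le_exp.2 hℓ
      _ = 1 := by
          rw [← Real.exp_add, ← Real.exp_add, ← hc]
          simp
  -- Jensen's inequality in the form `x ≤ exp x - 1`: the shift by `c` has made the average of the
  -- exponentials at most `1`.
  have hmain : t * rademacher v ≤ c := by
    have h1 : t * rademacher v - c
        = (2 ^ n)⁻¹ * ∑ s : Fin n → Bool, (t * (⨆ k, ∑ i, boolSign (s i) * v k i) - c) := by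
      rw [Finset.sum_sub_distrib, ← Finset.mul_sum, Finset.sum_const, Finset.card_univ,
        Fintype.card_fun, Fintype.card_bool, Fintype.card_fin, nsmul_eq_mul, mul_sub]
      push_cast
      rw [inv_mul_cancel_left₀ (by positivity), rademacher]
      ring
    have h2 : t * rademacher v - c
        ≤ (2 ^ n)⁻¹ * ∑ s : Fin n → Bool,
          (Real.exp (t * (⨆ k, ∑ i, boolSign (s i) * v k i) - c) - 1) := by
      rw [h1]
      refine mul_le_mul_of_nonneg_left (Finset.sum_le_sum fun s _ => ?_) (by positivity)
      linarith [Real.add_one_le_exp (t * (⨆ k, ∑ i, boolSign (s i) * v k i) - c)]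
    rw [Finset.sum_sub_distrib, Finset.sum_const, Finset.card_univ,
        Fintype.card_fun, Fintype.card_bool, Fintype.card_fin, nsmul_eq_mul, mul_sub] at h2
    push_cast at h2
    rw [inv_mul_cancel_left₀ (by positivity)] at h2
    linarith
  have : ℓ / t + t * r ^ 2 / 2 = c / t := by
    rw [hc]
    field_simp
  rw [this, le_div_iff₀ ht]
  linarith

/-- Cauchy–Schwarz for each sign pattern. It controls the last link of the chain, where only the
radius is small. -/
theorem rademacher_le_sqrt_mul {κ : Type*} [Finite κ] [Nonempty κ] {n : ℕ}
    (v : κ → Fin n → ℝ) {r : ℝ} (hr : 0 ≤ r) (hv : ∀ k, ∑ i, v k i ^ 2 ≤ r ^ 2) :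
    rademacher v ≤ Real.sqrt n * r := by
  have h : ∀ s : Fin n → Bool, ⨆ k, ∑ i, boolSign (s i) * v k i ≤ Real.sqrt n * r := by
    intro s
    refine ciSup_le fun k => ?_
    have h1 := Real.sum_mul_le_sqrt_mul_sqrt Finset.univ (fun i => boolSign (s i)) (v k)
    have h2 : ∑ i, boolSign (s i) ^ 2 = n := by
      have : ∀ i, boolSign (s i) ^ 2 = 1 := fun i => by rw [← sq_abs, abs_boolSign, one_pow]
      simp [this]
    rw [h2] at h1
    refine h1.trans (mul_le_mul_of_nonneg_left ?_ (Real.sqrt_nonneg _))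
    exact Real.sqrt_le_iff.2 ⟨hr, hv k⟩
  calc rademacher v ≤ (2 ^ n)⁻¹ * ∑ _s : Fin n → Bool, Real.sqrt n * r :=
        mul_le_mul_of_nonneg_left (Finset.sum_le_sum fun s _ => h s) (by positivity)
    _ = Real.sqrt n * r := by
        rw [Finset.sum_const, Finset.card_univ, Fintype.card_fun, Fintype.card_bool,
          Fintype.card_fin, nsmul_eq_mul]
        push_cast
        rw [inv_mul_cancel_left₀ (by positivity)]

theorem sum_sub_sq_le {n : ℕ} (x y z : Fin n → ℝ) {a b : ℝ} (ha : 0 ≤ a) (hb : 0 ≤ b)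
    (h1 : ∑ i, (z i - x i) ^ 2 ≤ a ^ 2) (h2 : ∑ i, (z i - y i) ^ 2 ≤ b ^ 2) :
    ∑ i, (x i - y i) ^ 2 ≤ (a + b) ^ 2 := by
  have key : ∀ p q : Fin n → ℝ, ∀ c : ℝ, 0 ≤ c → ∑ i, (p i - q i) ^ 2 ≤ c ^ 2 →
      dist (WithLp.toLp 2 p : EuclideanSpace ℝ (Fin n)) (WithLp.toLp 2 q) ≤ c := by
    intro p q c hc h
    rw [EuclideanSpace.dist_eq]
    refine Real.sqrt_le_iff.2 ⟨hc, ?_⟩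
    simpa [Real.dist_eq, sq_abs] using h
  have h3 := dist_triangle_left (WithLp.toLp 2 x : EuclideanSpace ℝ (Fin n)) (WithLp.toLp 2 y)
    (WithLp.toLp 2 z)
  have h4 : dist (WithLp.toLp 2 x : EuclideanSpace ℝ (Fin n)) (WithLp.toLp 2 y) ≤ a + b := by
    linarith [key z x a ha h1, key z y b hb h2]
  rw [EuclideanSpace.dist_eq] at h4
  have h5 := (Real.sqrt_le_iff.1 h4).2
  simpa [Real.dist_eq, sq_abs] using h5

/-- **Dudley's chaining bound** for a family whose metric entropy is at most `A² / ε²`. -/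
theorem rademacher_le_of_entropy {κ : Type*} [Finite κ] [Nonempty κ] {n : ℕ} (hn : 1 ≤ n)
    (v : κ → Fin n → ℝ) {A : ℝ} (hA : 0 < A)
    (hcov : ∀ ε : ℝ, 0 < ε → ∃ C : Finset (Fin n → ℝ), Real.log C.card ≤ A ^ 2 / ε ^ 2 ∧
      ∀ k, ∃ c ∈ C, ∑ i, (v k i - c i) ^ 2 ≤ ε ^ 2) :
    rademacher v ≤ 12 * A * (1 + Real.log n) := by
  classical
  -- At scale `e j` the entropy is at most `4^j / 4`. For `j = 0` this is below `log 2`, so the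
  -- coarsest cover is a single point.
  set e : ℕ → ℝ := fun j => 2 * A / 2 ^ j with he
  have hepos : ∀ j, 0 < e j := fun j => by positivity
  choose C hC hc using fun j => hcov (e j) (hepos j)
  choose π hπ hd using hc
  have hlog : ∀ j, Real.log (C j).card ≤ 4 ^ j / 4 := fun j => by
    refine (hC j).trans (le_of_eq ?_)
    have : (4 : ℝ) ^ j = 2 ^ j * 2 ^ j := by rw [← mul_pow]; norm_num
    rw [he, this]
    field_simp
    norm_num
  have hcpos : ∀ j, (0 : ℝ) < (C j).card := fun j => by
    exact_mod_cast Finset.card_pos.2 ⟨_, hπ j (Classical.arbitrary κ)⟩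
  have hzero : rademacher (π 0) ≤ A := by
    have h0 := hlog 0
    have hcard : (C 0).card ≤ 1 := by
      by_contra! h
      have h2 : Real.log 2 ≤ Real.log (C 0).card := Real.log_le_log two_pos (by exact_mod_cast h)
      have := Real.log_two_gt_d9
      norm_num at h0
      linarith
    have hconst : ∀ k, π 0 k = π 0 (Classical.arbitrary κ) := fun k =>
      Finset.card_le_one.1 hcard _ (hπ 0 k) _ (hπ 0 _)
    set r := Real.sqrt (∑ i, π 0 (Classical.arbitrary κ) i ^ 2)
    have hr : r ^ 2 = ∑ i, π 0 (Classical.arbitrary κ) i ^ 2 :=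
      Real.sq_sqrt (Finset.sum_nonneg fun _ _ => sq_nonneg _)
    have h1 : Real.log (C 0).card ≤ 0 :=
      Real.log_nonpos (hcpos 0).le (by exact_mod_cast hcard)
    -- With one point the entropy term is zero; this temperature makes the remaining term at most
    -- `A`, whatever the norm of the point.
    have h := rademacher_le_of_mem_finset (π 0) (C 0) (hπ 0) (r := r) (ℓ := 0)
      (t := 2 * A / (r ^ 2 + 1)) (fun k => by rw [hconst k, hr]) h1 (by positivity)
    refine h.trans ?_
    have : 2 * A / (r ^ 2 + 1) * r ^ 2 / 2 = A * (r ^ 2 / (r ^ 2 + 1)) := by field_simp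
    rw [zero_div, zero_add, this]
    refine mul_le_of_le_one_right hA.le ?_
    rw [div_le_one (by positivity)]
    linarith
  -- The entropy grows like `4^j` while the squared link length decays like `4^(-j)`, so each link
  -- costs the same; at the chosen temperature both terms of Massart's bound are `3 A`.
  have hstep : ∀ j, rademacher (fun k i => π (j + 1) k i - π j k i) ≤ 6 * A := by
    intro j
    set T := (C (j + 1) ×ˢ C j).image fun p i => p.1 i - p.2 i
    have hTcard : Real.log T.card ≤ 2 * 4 ^ (j + 1) / 4 := by
      have hT1 : (T.card : ℝ) ≤ (C (j + 1)).card * (C j).card := by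
        exact_mod_cast Finset.card_image_le.trans (Finset.card_product _ _).le
      have hTpos : (0 : ℝ) < T.card := by
        exact_mod_cast Finset.card_pos.2 ⟨_, Finset.mem_image_of_mem _ (Finset.mk_mem_product
          (hπ (j + 1) (Classical.arbitrary κ)) (hπ j (Classical.arbitrary κ)))⟩
      have h1 := Real.log_le_log hTpos hT1
      rw [Real.log_mul (hcpos _).ne' (hcpos _).ne'] at h1
      have h2 := hlog (j + 1)
      have h3 := hlog j
      have h4 : (4 : ℝ) ^ (j + 1) = 4 * 4 ^ j := pow_succ' _ _
      have h5 : (0 : ℝ) < 4 ^ j := by positivity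
      rw [h4] at h2 ⊢
      linarith
    have h := rademacher_le_of_mem_finset (fun k i => π (j + 1) k i - π j k i) T
      (fun k => Finset.mem_image.2 ⟨(π (j + 1) k, π j k), Finset.mem_product.2 ⟨hπ _ k, hπ _ k⟩, rfl⟩)
      (r := e (j + 1) + e j) (t := 4 ^ (j + 1) / (6 * A))
      (fun k => sum_sub_sq_le _ _ _ (hepos _).le (hepos _).le (hd (j + 1) k) (hd j k)) hTcard
      (by positivity)
    refine h.trans (le_of_eq ?_)
    have h1 : e (j + 1) + e j = 6 * A / 2 ^ (j + 1) := by
      simp only [he, pow_succ]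
      field_simp
      norm_num
    have h2 : (4 : ℝ) ^ (j + 1) = 2 ^ (j + 1) * 2 ^ (j + 1) := by rw [← mul_pow]; norm_num
    rw [h1, h2]
    field_simp
    norm_num
  have hchain : ∀ j : ℕ, rademacher (π j) ≤ A + 6 * A * j := by
    intro j
    induction j with
    | zero => simpa using hzero
    | succ j ih =>
      have h := rademacher_add_le (π j) (fun k i => π (j + 1) k i - π j k i)
      simp only [add_sub_cancel] at h
      push_cast
      linarith [hstep j]
  -- The chain stops once `√n ≤ 2^J`: then the crude bound `√n * e J` on the remainder is at most `2
  -- A`.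
  set J := Nat.log 2 n + 1 with hJ
  have hn0 : (1 : ℝ) ≤ n := by exact_mod_cast hn
  have hnJ : (n : ℝ) ≤ 2 ^ J := by exact_mod_cast (Nat.lt_pow_succ_log_self (by norm_num) n).le
  have hlast : rademacher (fun k i => v k i - π J k i) ≤ 2 * A := by
    refine (rademacher_le_sqrt_mul _ (hepos J).le (hd J)).trans ?_
    have h1 : Real.sqrt n ≤ 2 ^ J := (Real.sqrt_le_iff.2 ⟨by linarith, by nlinarith⟩ : √(n:ℝ) ≤ n).trans hnJ
    calc Real.sqrt n * e J ≤ 2 ^ J * e J := mul_le_mul_of_nonneg_right h1 (hepos J).le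
      _ = 2 * A := by rw [he]; field_simp
  have hJle : (J : ℝ) ≤ 1 + 2 * Real.log n := by
    have h1 : ((2 : ℝ) ^ Nat.log 2 n) ≤ n := by exact_mod_cast Nat.pow_log_le_self 2 (by omega)
    have h2 := Real.log_le_log (by positivity) h1
    rw [Real.log_pow] at h2
    have h3 := Real.log_two_gt_d9
    rw [hJ]
    push_cast
    nlinarith [(Nat.cast_nonneg (Nat.log 2 n) : (0 : ℝ) ≤ _)]
  have h := rademacher_add_le (π J) (fun k i => v k i - π J k i)
  simp only [add_sub_cancel] at h
  have hlogn := Real.log_nonneg hn0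
  have h1 : 6 * A * J ≤ 6 * A * (1 + 2 * Real.log n) := by gcongr
  calc rademacher v ≤ A + 6 * A * J + 2 * A := by
        have : rademacher v = rademacher (fun k i => v k i) := rfl
        linarith [hchain J]
    _ ≤ 12 * A * (1 + Real.log n) := by nlinarith

/-! ### Maurey's method and covers of classes of linear maps -/

/-- **Maurey's empirical method**, in its greedy form. -/
theorem exists_norm_sum_sub_smul_sq_le {H σ : Type*} [NormedAddCommGroup H] [InnerProductSpace ℝ H]
    (g : σ → H) {b : ℝ} (hg : ∀ s, ‖g s‖ ≤ b) {v : H} (hv : v ∈ convexHull ℝ (Set.range g)) (k : ℕ) :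
    ∃ f : Fin k → σ, ‖(∑ i, g (f i)) - (k : ℝ) • v‖ ^ 2 ≤ k * b ^ 2 := by
  induction k with
  | zero => exact ⟨Fin.elim0, by simp⟩
  | succ k ih =>
    obtain ⟨f, hf⟩ := ih
    set u := (∑ i, g (f i)) - (k : ℝ) • v with hu
    -- Some generator has inner product with `u - v` at most that of `v`. With this choice the
    -- squared error grows by at most `b²`.
    obtain ⟨_, ⟨s, rfl⟩, hs⟩ :=
      ((innerₗ H (u - v)).concaveOn convex_univ).exists_le_of_mem_convexHull (Set.subset_univ _) hv
    simp only [innerₗ_apply_apply] at hs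
    refine ⟨Fin.snoc f s, ?_⟩
    have h1 : (∑ i, g ((Fin.snoc f s : Fin (k + 1) → σ) i)) - ((k + 1 : ℕ) : ℝ) • v
        = (u - v) + g s := by
      rw [Fin.sum_univ_castSucc]
      simp only [Fin.snoc_castSucc, Fin.snoc_last, hu]
      push_cast
      rw [add_smul, one_smul]
      abel
    rw [h1, norm_add_sq_real]
    have h2 : ‖u‖ ^ 2 = ‖u - v‖ ^ 2 + 2 * inner ℝ (u - v) v + ‖v‖ ^ 2 := by
      rw [← norm_add_sq_real, sub_add_cancel]
    have h3 : ‖g s‖ ^ 2 ≤ b ^ 2 := pow_le_pow_left₀ (norm_nonneg _) (hg s) 2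
    push_cast
    nlinarith [sq_nonneg ‖v‖]

/-- The signed atoms get the weights `|c j|`; the missing mass `1 - ∑ |c j|` goes to the zero atom
at `none`. -/
theorem sum_smul_mem_convexHull_symm {H τ : Type*} [AddCommGroup H] [Module ℝ H] [Fintype τ]
    (h : τ → H) (c : τ → ℝ) (hc : ∑ j, |c j| ≤ 1) :
    ∑ j, c j • h j ∈ convexHull ℝ (Set.range fun o : Option (τ × Bool) =>
      o.elim 0 fun p => boolSign p.2 • h p.1) := by
  set g : Option (τ × Bool) → H := fun o => o.elim 0 fun p => boolSign p.2 • h p.1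
  set w : Option τ → ℝ := fun o => o.elim (1 - ∑ j, |c j|) fun j => |c j|
  set z : Option τ → H := fun o => o.elim 0 fun j => boolSign (decide (0 ≤ c j)) • h j
  have hz : ∀ o, z o ∈ convexHull ℝ (Set.range g) := fun o => subset_convexHull ℝ _ <| by
    rcases o with _ | j
    · exact ⟨none, rfl⟩
    · exact ⟨some (j, decide (0 ≤ c j)), rfl⟩
  have h1 := (convex_convexHull ℝ (Set.range g)).sum_mem (t := Finset.univ) (w := w) (z := z)
    (fun o _ => by
      rcases o with _ | j
      · exact sub_nonneg.2 hc
      · exact abs_nonneg _)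
    (by simp [w, Fintype.sum_option]) fun o _ => hz o
  convert h1 using 1
  rw [Fintype.sum_option]
  simp only [w, z, Option.elim_none, Option.elim_some, smul_zero, zero_add, smul_smul]
  refine Finset.sum_congr rfl fun j _ => ?_
  congr 1
  by_cases hj : 0 ≤ c j
  · simp [boolSign, hj, abs_of_nonneg hj]
  · simp [boolSign, hj, abs_of_neg (not_le.1 hj)]

/-- By Maurey, averages of `k` generators come within `b / √k` of every hull point in question.
Replacing each useful average by a nearby element of `V` doubles the radius, but the centres then
satisfy every constraint that defines `V`. -/
theorem exists_internal_cover_of_convexHull {H σ α : Type*} [NormedAddCommGroup H]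
    [InnerProductSpace ℝ H] [Fintype σ] (g : σ → H) {b : ℝ} (hb : 0 ≤ b) (hg : ∀ s, ‖g s‖ ≤ b)
    (φ : α → H) (V : Set α) (hV : ∀ A ∈ V, φ A ∈ convexHull ℝ (Set.range g)) {k : ℕ} (hk : 1 ≤ k) :
    ∃ C : Finset α, (∀ A ∈ C, A ∈ V) ∧ C.card ≤ Fintype.card σ ^ k ∧
      ∀ A ∈ V, ∃ A' ∈ C, ‖φ A - φ A'‖ ≤ 2 * b / Real.sqrt k := by
  classical
  have hk0 : (0 : ℝ) < k := by exact_mod_cast hk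
  set r := b / Real.sqrt k with hr
  set center : (Fin k → σ) → H := fun f => (k : ℝ)⁻¹ • ∑ i, g (f i)
  have happrox : ∀ A ∈ V, ∃ f, ‖φ A - center f‖ ≤ r := by
    intro A hA
    obtain ⟨f, hf⟩ := exists_norm_sum_sub_smul_sq_le g hg (hV A hA) k
    refine ⟨f, ?_⟩
    have h1 : φ A - center f = -((k : ℝ)⁻¹ • ((∑ i, g (f i)) - (k : ℝ) • φ A)) := by
      rw [smul_sub, smul_smul, inv_mul_cancel₀ hk0.ne', one_smul, neg_sub]
    rw [h1, norm_neg, norm_smul, Real.norm_eq_abs, abs_of_pos (by positivity), hr]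
    have h2 : ‖(∑ i, g (f i)) - (k : ℝ) • φ A‖ ≤ Real.sqrt k * b := by
      refine abs_le_of_sq_le_sq' ?_ (by positivity) |>.2
      rw [mul_pow, Real.sq_sqrt hk0.le]
      exact hf
    calc (k : ℝ)⁻¹ * ‖(∑ i, g (f i)) - (k : ℝ) • φ A‖ ≤ (k : ℝ)⁻¹ * (Real.sqrt k * b) := by gcongr
      _ = b / Real.sqrt k := by
        have h3 : Real.sqrt k * Real.sqrt k = k := Real.mul_self_sqrt hk0.le
        have h4 : 0 < Real.sqrt k := Real.sqrt_pos.2 hk0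
        field_simp
        nlinarith
  have hrep : ∀ f : {f : Fin k → σ // ∃ A ∈ V, ‖φ A - center f‖ ≤ r},
      ∃ A ∈ V, ‖φ A - center f.1‖ ≤ r := fun f => f.2
  choose rep hrepV hrepd using hrep
  refine ⟨Finset.univ.image rep, ?_, ?_, ?_⟩
  · intro A hA
    obtain ⟨f, -, rfl⟩ := Finset.mem_image.1 hA
    exact hrepV f
  · refine Finset.card_image_le.trans ?_
    rw [Finset.card_univ]
    refine (Fintype.card_subtype_le _).trans ?_
    simp
  · intro A hA
    obtain ⟨f, hf⟩ := happrox A hA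
    refine ⟨rep ⟨f, A, hA, hf⟩, Finset.mem_image_of_mem _ (Finset.mem_univ _), ?_⟩
    have h1 := hrepd ⟨f, A, hA, hf⟩
    have h2 := norm_sub_le_norm_sub_add_norm_sub (φ A) (center f) (φ (rep ⟨f, A, hA, hf⟩))
    rw [norm_sub_rev (center f)] at h2
    have h3 : 2 * b / Real.sqrt k = r + r := by rw [hr]; ring
    linarith

/-- An orthonormal basis of the span of the points: its size is bounded by their number, which keeps
the ambient dimension out of the count of atoms. -/
theorem exists_orthonormal_expansion {E ι : Type*} [NormedAddCommGroup E] [InnerProductSpace ℝ E]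
    [Fintype ι] (x : ι → E) :
    ∃ r ≤ Fintype.card ι, ∃ u : Fin r → E, Orthonormal ℝ u ∧
      ∀ i, ∑ j, inner ℝ (u j) (x i) • u j = x i := by
  set U := Submodule.span ℝ (Set.range x)
  have : FiniteDimensional ℝ U := FiniteDimensional.span_of_finite ℝ (Set.finite_range x)
  set B := stdOrthonormalBasis ℝ U
  refine ⟨Module.finrank ℝ U, finrank_range_le_card x, fun j => (B j : E), ?_, fun i => ?_⟩
  · exact B.orthonormal.comp_linearIsometry U.subtypeₗᵢ
  · have h := congrArg (Subtype.val : U → E)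
      (B.sum_repr' ⟨x i, Submodule.subset_span (Set.mem_range_self i)⟩)
    simpa using h

/-- The images of the points `x i` under the matrix with rows `w s`, as a single Euclidean vector. -/
def rowImages {p q : ℕ} {ι : Type*} [Fintype ι] (x : ι → Euc p) (w : Fin q → Euc p) :
    EuclideanSpace ℝ (ι × Fin q) :=
  WithLp.toLp 2 fun e => inner ℝ (w e.2) (x e.1)

theorem norm_rowImages_sq {p q : ℕ} {ι : Type*} [Fintype ι] (x : ι → Euc p) (w : Fin q → Euc p) :
    ‖rowImages x w‖ ^ 2 = ∑ s, ∑ i, inner ℝ (w s) (x i) ^ 2 := by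
  rw [EuclideanSpace.norm_sq_eq, Fintype.sum_prod_type, Finset.sum_comm]
  simp [rowImages, sq_abs]

theorem norm_rowImages_le {p q : ℕ} {ι : Type*} [Fintype ι] (x : ι → Euc p) (w : Fin q → Euc p)
    {a b : ℝ} (hb : 0 ≤ b) (hw : ∑ s, ‖w s‖ ≤ a) (hx : ∑ i, ‖x i‖ ^ 2 ≤ b ^ 2) :
    ‖rowImages x w‖ ≤ a * b := by
  have hs : 0 ≤ ∑ s, ‖w s‖ := Finset.sum_nonneg fun _ _ => norm_nonneg _
  refine (abs_le_of_sq_le_sq' ?_ (mul_nonneg (hs.trans hw) hb)).2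
  rw [norm_rowImages_sq]
  calc ∑ s, ∑ i, inner ℝ (w s) (x i) ^ 2 ≤ ∑ s, ∑ i, ‖w s‖ ^ 2 * ‖x i‖ ^ 2 := by
        refine Finset.sum_le_sum fun s _ => Finset.sum_le_sum fun i _ => ?_
        rw [← mul_pow, ← sq_abs]
        exact pow_le_pow_left₀ (abs_nonneg _) (abs_real_inner_le_norm _ _) 2
    _ = (∑ s, ‖w s‖ ^ 2) * ∑ i, ‖x i‖ ^ 2 := by rw [Finset.sum_mul_sum]
    _ ≤ a ^ 2 * b ^ 2 := by
        refine mul_le_mul ?_ hx (Finset.sum_nonneg fun _ _ => sq_nonneg _) (sq_nonneg _)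
        exact (Finset.sum_sq_le_sq_sum_of_nonneg fun s _ => norm_nonneg _).trans
          (pow_le_pow_left₀ hs hw 2)
    _ = (a * b) ^ 2 := by ring

/-- An atom is the action of one basis direction `u j` in one row, rescaled to norm at most `a b`.
The coefficients are then `⟨w s, u j⟩ c j / (a b)`, where `c j` is the norm of the `j`-th
coordinates of the data; Cauchy–Schwarz in `j` and Bessel's inequality bound the sum of their
absolute values by `1`. -/
theorem exists_atoms_rowImages {p q : ℕ} {ι : Type*} [Fintype ι] (x : ι → Euc p) {a b : ℝ}
    (ha : 0 < a) (hb : 0 < b) (hx : ∑ i, ‖x i‖ ^ 2 ≤ b ^ 2) :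
    ∃ r ≤ Fintype.card ι, ∃ g : Option ((Fin q × Fin r) × Bool) → EuclideanSpace ℝ (ι × Fin q),
      (∀ s, ‖g s‖ ≤ a * b) ∧ ∀ w : Fin q → Euc p, ∑ s, ‖w s‖ ≤ a →
        rowImages x w ∈ convexHull ℝ (Set.range g) := by
  obtain ⟨r, hr, u, hu, hexp⟩ := exists_orthonormal_expansion x
  set c : Fin r → ℝ := fun j => Real.sqrt (∑ i, inner ℝ (u j) (x i) ^ 2) with hc
  have hc0 : ∀ j, 0 ≤ c j := fun j => Real.sqrt_nonneg _
  have hcsq : ∀ j, c j ^ 2 = ∑ i, inner ℝ (u j) (x i) ^ 2 := fun j =>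
    Real.sq_sqrt (Finset.sum_nonneg fun _ _ => sq_nonneg _)
  have hcz : ∀ j, c j = 0 → ∀ i, inner ℝ (u j) (x i) = (0 : ℝ) := by
    intro j hj i
    have h := hcsq j
    rw [hj, zero_pow two_ne_zero] at h
    have := (Finset.sum_eq_zero_iff_of_nonneg fun _ _ => sq_nonneg _).1 h.symm i (Finset.mem_univ i)
    exact pow_eq_zero_iff two_ne_zero |>.1 this
  have hcb : ∑ j, c j ^ 2 ≤ b ^ 2 := by
    simp only [hcsq]
    rw [Finset.sum_comm]
    refine (Finset.sum_le_sum fun i _ => ?_).trans hx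
    have := hu.sum_inner_products_le (s := Finset.univ) (x i)
    simpa [sq_abs] using this
  -- If `c t.2 = 0`, division by zero makes the atom zero, as it should be: all data are orthogonal
  -- to that direction.
  set h : Fin q × Fin r → EuclideanSpace ℝ (ι × Fin q) := fun t =>
    WithLp.toLp 2 fun e => if e.2 = t.1 then a * b / c t.2 * inner ℝ (u t.2) (x e.1) else 0 with hh
  have hnorm : ∀ t, ‖h t‖ ≤ a * b := by
    intro t
    refine (abs_le_of_sq_le_sq' ?_ (by positivity)).2
    rw [EuclideanSpace.norm_sq_eq, Fintype.sum_prod_type]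
    simp only [hh, Real.norm_eq_abs, sq_abs, ite_pow, zero_pow two_ne_zero, Finset.sum_ite_eq',
      Finset.mem_univ, if_true, mul_pow, ← Finset.mul_sum, ← hcsq]
    by_cases h0 : c t.2 = 0
    · rw [h0]; simp; positivity
    · rw [div_pow, div_mul_cancel₀ _ (pow_ne_zero 2 h0), mul_pow]
  refine ⟨r, hr, fun o => o.elim 0 fun t => boolSign t.2 • h t.1, fun s => ?_, fun w hw => ?_⟩
  · rcases s with _ | t
    · simp; positivity
    · simp only [Option.elim_some, norm_smul, Real.norm_eq_abs, abs_boolSign, one_mul]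
      exact hnorm _
  · have hmem := sum_smul_mem_convexHull_symm h
      (fun t => inner ℝ (w t.1) (u t.2) * c t.2 / (a * b)) ?_
    · convert hmem using 1
      ext e
      rw [WithLp.ofLp_sum, Finset.sum_apply, Fintype.sum_prod_type, Finset.sum_comm]
      simp only [rowImages, hh, PiLp.smul_apply, smul_eq_mul, mul_ite, mul_zero, Finset.sum_ite_eq,
        Finset.mem_univ, if_true]
      conv_lhs => rw [← hexp e.1, inner_sum]
      refine Finset.sum_congr rfl fun j _ => ?_
      rw [inner_smul_right]
      by_cases h0 : c j = 0
      · rw [hcz j h0]; simp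
      · field_simp
    · rw [Fintype.sum_prod_type]
      have h1 : ∀ s, ∑ j, |inner ℝ (w s) (u j) * c j / (a * b)| ≤ ‖w s‖ / a := by
        intro s
        have h2 : ∑ j, |inner ℝ (w s) (u j)| * c j ≤ ‖w s‖ * b := by
          refine (Real.sum_mul_le_sqrt_mul_sqrt _ _ _).trans ?_
          refine mul_le_mul (Real.sqrt_le_iff.2 ⟨norm_nonneg _, ?_⟩)
            (Real.sqrt_le_iff.2 ⟨hb.le, hcb⟩) (Real.sqrt_nonneg _) (norm_nonneg _)
          have := hu.sum_inner_products_le (s := Finset.univ) (w s)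
          simpa [real_inner_comm] using this
        calc ∑ j, |inner ℝ (w s) (u j) * c j / (a * b)|
            = (∑ j, |inner ℝ (w s) (u j)| * c j) / (a * b) := by
              rw [Finset.sum_div]
              refine Finset.sum_congr rfl fun j _ => ?_
              rw [abs_div, abs_mul, abs_of_nonneg (hc0 j), abs_of_pos (mul_pos ha hb)]
          _ ≤ ‖w s‖ * b / (a * b) := by gcongr
          _ = ‖w s‖ / a := by field_simp
      refine (Finset.sum_le_sum fun s _ => h1 s).trans ?_
      rw [← Finset.sum_div, div_le_one ha]
      exact hw

/-- Metric entropy of a class of linear maps with a bound on the `(2,1)`-norm of the transposed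
deviation from a reference matrix, in the Frobenius norm of the images of finitely many points.
The input dimension does not enter. -/
theorem exists_cover_linear {p q : ℕ} {ι : Type*} [Fintype ι] (x : ι → Euc p)
    (A₀ : Matrix (Fin q) (Fin p) ℝ) (V : Set (Matrix (Fin q) (Fin p) ℝ)) {a b ε : ℝ}
    (hV : ∀ A ∈ V, norm21 (A - A₀).transpose ≤ a) (ha : 0 ≤ a) (hb : 0 ≤ b)
    (hx : ∑ i, ‖x i‖ ^ 2 ≤ b ^ 2) (hε : 0 ≤ ε) (hεa : ε = 0 → a = 0) :
    ∃ C : Finset (Matrix (Fin q) (Fin p) ℝ), (∀ A ∈ C, A ∈ V) ∧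
      Real.log C.card ≤ 8 * (a * b / ε) ^ 2 * Real.log (2 * (q * Fintype.card ι) + 1) ∧
      ∀ A ∈ V, ∃ A' ∈ C, ∑ i, ‖Matrix.toEuclideanLin A (x i) - Matrix.toEuclideanLin A' (x i)‖ ^ 2
        ≤ ε ^ 2 := by
  classical
  set row : Matrix (Fin q) (Fin p) ℝ → Fin q → Euc p := fun A s => WithLp.toLp 2 ((A - A₀) s)
  have hrow : ∀ A ∈ V, ∑ s, ‖row A s‖ ≤ a := fun A hA => hV A hA
  have hdist : ∀ A A', ∑ i, ‖Matrix.toEuclideanLin A (x i) - Matrix.toEuclideanLin A' (x i)‖ ^ 2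
      = ‖rowImages x (row A) - rowImages x (row A')‖ ^ 2 := by
    intro A A'
    rw [EuclideanSpace.norm_sq_eq, Fintype.sum_prod_type]
    refine Finset.sum_congr rfl fun i _ => ?_
    rw [EuclideanSpace.norm_sq_eq]
    refine Finset.sum_congr rfl fun s _ => ?_
    congr 2
    simp only [rowImages, row, PiLp.sub_apply, PiLp.inner_apply, Matrix.toLpLin_apply,
      Matrix.mulVec, dotProduct, ← Finset.sum_sub_distrib, RCLike.inner_apply, conj_trivial,
      Matrix.sub_apply]
    exact Finset.sum_congr rfl fun j _ => by ring
  have hL : 0 ≤ Real.log (2 * (q * Fintype.card ι) + 1) :=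
    Real.log_nonneg (by have : (0 : ℝ) ≤ q * Fintype.card ι := by positivity
                        linarith)
  -- Here any one element covers `V`; this includes `ε = 0`, which forces `a = 0`.
  by_cases hsmall : 2 * (a * b) ≤ ε
  · rcases V.eq_empty_or_nonempty with rfl | ⟨A', hA'⟩
    · exact ⟨∅, by simp, by simp; positivity, by simp⟩
    · refine ⟨{A'}, by simpa using hA', by simp; positivity, fun A hA => ⟨A', by simp, ?_⟩⟩
      rw [hdist]
      refine pow_le_pow_left₀ (norm_nonneg _) ((norm_sub_le _ _).trans ?_) 2
      linarith [norm_rowImages_le x _ hb (hrow A hA) hx, norm_rowImages_le x _ hb (hrow A' hA') hx]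
  · have hab : 0 < a * b := by linarith
    have ha' : 0 < a := ha.lt_of_ne fun h => by simp [← h] at hab
    have hb' : 0 < b := hb.lt_of_ne fun h => by simp [← h] at hab
    have hε' : 0 < ε := hε.lt_of_ne fun h => ha'.ne' (hεa h.symm)
    obtain ⟨r, hr, g, hg, hgV⟩ := exists_atoms_rowImages (q := q) x ha' hb' hx
    -- The number of atoms that brings the radius `2 a b / √k` down to `ε`. As `y ≥ 1`, rounding up
    -- costs at most a factor `2`, whence `8 = 2 * 2²`.
    set y := (2 * (a * b) / ε) ^ 2 with hy
    have hy1 : 1 ≤ y := one_le_pow₀ (by rw [le_div_iff₀ hε']; linarith)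
    set k := ⌈y⌉₊
    have hk : 1 ≤ k := Nat.one_le_ceil_iff.2 (by linarith)
    have hyk : y ≤ k := Nat.le_ceil _
    have hky : (k : ℝ) ≤ 2 * y := by linarith [Nat.ceil_lt_add_one (show 0 ≤ y by linarith)]
    obtain ⟨C, hCV, hCc, hC⟩ := exists_internal_cover_of_convexHull g hab.le hg
      (fun A => rowImages x (row A)) V (fun A hA => hgV _ (hrow A hA)) hk
    refine ⟨C, hCV, ?_, fun A hA => ?_⟩
    · rcases C.eq_empty_or_nonempty with rfl | hne
      · simp; positivity
      have hcpos : (0 : ℝ) < C.card := by exact_mod_cast hne.card_pos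
      have h1 : (C.card : ℝ) ≤ (2 * (q * Fintype.card ι) + 1) ^ k := by
        have h2 : Fintype.card (Option ((Fin q × Fin r) × Bool)) ≤ 2 * (q * Fintype.card ι) + 1 := by
          simp only [Fintype.card_option, Fintype.card_prod, Fintype.card_fin, Fintype.card_bool]
          nlinarith [Nat.mul_le_mul_left q hr]
        exact_mod_cast hCc.trans (Nat.pow_le_pow_left h2 k)
      have h3 := Real.log_le_log hcpos h1
      rw [Real.log_pow] at h3
      refine h3.trans (mul_le_mul_of_nonneg_right (hky.trans (le_of_eq ?_)) hL)
      rw [hy]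
      ring
    · obtain ⟨A', hA', h⟩ := hC A hA
      refine ⟨A', hA', ?_⟩
      rw [hdist]
      refine pow_le_pow_left₀ (norm_nonneg _) (h.trans ?_) 2
      have hk0 : (0 : ℝ) < k := by linarith
      have hs : 2 * (a * b) / ε ≤ Real.sqrt k := Real.le_sqrt_of_sq_le hyk
      rw [div_le_iff₀ (Real.sqrt_pos.2 hk0)]
      rw [div_le_iff₀ hε'] at hs
      linarith

/-! ### Metric entropy of networks -/

theorem sum_norm_add_sq_le {ι E : Type*} [Fintype ι] [SeminormedAddCommGroup E] (u v : ι → E)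
    {s t : ℝ} (hs : 0 ≤ s) (ht : 0 ≤ t) (hu : ∑ i, ‖u i‖ ^ 2 ≤ s ^ 2) (hv : ∑ i, ‖v i‖ ^ 2 ≤ t ^ 2) :
    ∑ i, ‖u i + v i‖ ^ 2 ≤ (s + t) ^ 2 := by
  have h1 : ‖(WithLp.toLp 2 u : PiLp 2 fun _ : ι => E)‖ ≤ s :=
    (abs_le_of_sq_le_sq' (by rw [PiLp.norm_sq_eq_of_L2]; exact hu) hs).2
  have h2 : ‖(WithLp.toLp 2 v : PiLp 2 fun _ : ι => E)‖ ≤ t :=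
    (abs_le_of_sq_le_sq' (by rw [PiLp.norm_sq_eq_of_L2]; exact hv) ht).2
  have h3 := pow_le_pow_left₀ (norm_nonneg _) ((norm_add_le (WithLp.toLp 2 u : PiLp 2 fun _ : ι => E)
    (WithLp.toLp 2 v)).trans (add_le_add h1 h2)) 2
  rwa [PiLp.norm_sq_eq_of_L2] at h3

theorem norm_toEuclideanLin_le {m n : ℕ} (A : Matrix (Fin m) (Fin n) ℝ) {ρ : ℝ}
    (hA : matrixSpectralNorm A ≤ ρ) (x : Euc n) : ‖Matrix.toEuclideanLin A x‖ ≤ ρ * ‖x‖ :=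
  ((Matrix.toEuclideanLin A).toContinuousLinearMap.le_opNorm x).trans
    (mul_le_mul_of_nonneg_right hA (norm_nonneg _))

theorem lipProd_succ (n : ℕ) (ρ : ℕ → ℝ) (σ : ℕ → ℝ≥0) :
    lipProd (n + 1) ρ σ = lipProd n ρ σ * (ρ n * σ n) := Finset.prod_range_succ _ _

theorem lipProd_nonneg {n L : ℕ} (hn : n ≤ L) {ρ : ℕ → ℝ} (hρ : ∀ ℓ < L, 0 < ρ ℓ) (σ : ℕ → ℝ≥0) :
    0 ≤ lipProd n ρ σ :=
  Finset.prod_nonneg fun ℓ hℓ =>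
    mul_nonneg (hρ ℓ ((Finset.mem_range.1 hℓ).trans_le hn)).le (σ ℓ).2

theorem norm_act_le {E F : Type*} [NormedAddCommGroup E] [NormedAddCommGroup F] {f : E → F}
    {σ : ℝ≥0} (hf : LipschitzWith σ f) (h0 : f 0 = 0) (x : E) : ‖f x‖ ≤ σ * ‖x‖ := by
  simpa [h0] using hf.dist_le_mul x 0

section Network

variable {L : ℕ} {width : ℕ → ℕ} {act : Activations width} {σ : ℕ → ℝ≥0} {ρ a : ℕ → ℝ}
  {Θ₀ : Weights width}

theorem norm_network_le (hσ : ∀ ℓ < L, LipschitzWith (σ ℓ) (act ℓ)) (h0 : ∀ ℓ < L, act ℓ 0 = 0)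
    {Θ : Weights width} (hΘ : Θ ∈ weightSet L ρ a Θ₀) (x : Euc (width 0)) {n : ℕ} (hn : n ≤ L) :
    ‖network act Θ n x‖ ≤ lipProd n ρ σ * ‖x‖ := by
  induction n with
  | zero => simp [network, lipProd]
  | succ n ih =>
    have hρn : 0 ≤ ρ n := (norm_nonneg _).trans (hΘ n hn).1
    calc ‖network act Θ (n + 1) x‖ ≤ σ n * ‖Matrix.toEuclideanLin (Θ n) (network act Θ n x)‖ :=
          norm_act_le (hσ n hn) (h0 n hn) _
      _ ≤ σ n * (ρ n * (lipProd n ρ σ * ‖x‖)) := by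
          gcongr
          exact (norm_toEuclideanLin_le _ (hΘ n hn).1 _).trans
            (mul_le_mul_of_nonneg_left (ih (by omega)) hρn)
      _ = lipProd (n + 1) ρ σ * ‖x‖ := by rw [lipProd_succ]; ring

/-- Metric entropy of the outputs of a network class at finitely many points, for a free choice of
the weights `w ℓ` with which the layers contribute to the total resolution. -/
theorem exists_cover_network_of_weights {ι : Type*} [Fintype ι]
    (hσ : ∀ ℓ < L, LipschitzWith (σ ℓ) (act ℓ)) (hσ0 : ∀ ℓ < L, 0 < σ ℓ)
    (h0 : ∀ ℓ < L, act ℓ 0 = 0) (hρ : ∀ ℓ < L, 0 < ρ ℓ) (ha : ∀ ℓ < L, 0 ≤ a ℓ)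
    (y : ι → Euc (width 0)) {b τ Λ : ℝ} (hb : 0 ≤ b) (hy : ∑ i, ‖y i‖ ^ 2 ≤ b ^ 2) (hτ : 0 < τ)
    (hΛ : ∀ ℓ < L, Real.log (2 * (width (ℓ + 1) * Fintype.card ι) + 1) ≤ Λ)
    (w : ℕ → ℝ) (hw : ∀ ℓ < L, 0 ≤ w ℓ) (hwa : ∀ ℓ < L, w ℓ = 0 → a ℓ = 0) {n : ℕ} (hn : n ≤ L) :
    ∃ C : Finset (ι → Euc (width n)), (∀ c ∈ C, ∀ i, ‖c i‖ ≤ lipProd n ρ σ * ‖y i‖) ∧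
      Real.log C.card ≤ ∑ ℓ ∈ Finset.range n, 8 * (a ℓ / ρ ℓ / w ℓ * (b / τ)) ^ 2 * Λ ∧
      ∀ Θ ∈ weightSet L ρ a Θ₀, ∃ c ∈ C,
        ∑ i, ‖network act Θ n (y i) - c i‖ ^ 2
          ≤ (τ * lipProd n ρ σ * ∑ ℓ ∈ Finset.range n, w ℓ) ^ 2 := by
  classical
  induction n with
  | zero => exact ⟨{y}, by simp [lipProd], by simp, fun Θ _ => ⟨y, by simp, by simp [network]⟩⟩
  | succ n ih =>
    have hnL : n < L := hn
    obtain ⟨C, hC1, hC2, hC3⟩ := ih (by omega)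
    have hP0 := lipProd_nonneg (show n ≤ L by omega) hρ σ
    have hP : 0 < lipProd n ρ σ := Finset.prod_pos fun ℓ hℓ => by
      have hℓ' : ℓ < L := (Finset.mem_range.1 hℓ).trans hnL
      exact mul_pos (hρ ℓ hℓ') (hσ0 ℓ hℓ')
    have hρn := hρ n hnL
    have hΛ0 : 0 ≤ Λ := (Real.log_nonneg (by
      have : (0 : ℝ) ≤ width (n + 1) * Fintype.card ι := by positivity
      linarith)).trans (hΛ n hnL)
    set V : Set (Matrix (Fin (width (n + 1))) (Fin (width n)) ℝ) :=
      {A | matrixSpectralNorm A ≤ ρ n ∧ norm21 (A - Θ₀ n).transpose ≤ a n} with hV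
    -- Scaled so that, after the Lipschitz factor `σ n`, layer `n` adds exactly `τ * w n * lipProd
    -- (n + 1) ρ σ` to the error.
    set εn := τ * w n * (lipProd n ρ σ * ρ n) with hεn
    have hεn0 : 0 ≤ εn := mul_nonneg (mul_nonneg hτ.le (hw n hnL)) (by positivity)
    have hcsum : ∀ c ∈ C, ∑ i, ‖c i‖ ^ 2 ≤ (lipProd n ρ σ * b) ^ 2 := by
      intro c hc
      calc ∑ i, ‖c i‖ ^ 2 ≤ ∑ i, (lipProd n ρ σ) ^ 2 * ‖y i‖ ^ 2 :=
            Finset.sum_le_sum fun i _ => by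
              rw [← mul_pow]; exact pow_le_pow_left₀ (norm_nonneg _) (hC1 c hc i) 2
        _ ≤ (lipProd n ρ σ * b) ^ 2 := by
            rw [← Finset.mul_sum, mul_pow]
            exact mul_le_mul_of_nonneg_left hy (sq_nonneg _)
    -- Each centre `c` of the first `n` layers gets its own cover of the next matrix, at the data
    -- `c`. All have the same entropy bound, so log-cardinalities add up over the layers.
    have hlin := fun c : C => exists_cover_linear c.1 (Θ₀ n) V (fun A hA => hA.2) (ha n hnL)
      (mul_nonneg hP0 hb) (hcsum c.1 c.2) hεn0 (fun h => hwa n hnL (by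
        rcases mul_eq_zero.1 h with h | h
        · exact (mul_eq_zero.1 h).resolve_left hτ.ne'
        · exact absurd h (mul_pos hP hρn).ne'))
    choose 𝒜 h𝒜V h𝒜c h𝒜 using hlin
    set ent := 8 * (a n / ρ n / w n * (b / τ)) ^ 2 * Λ with hent
    have hent0 : 0 ≤ ent := by positivity
    have hcard : ∀ c, ((𝒜 c).card : ℝ) ≤ Real.exp ent := by
      intro c
      have h1 : Real.log (𝒜 c).card ≤ ent := by
        refine (h𝒜c c).trans ?_
        have h2 : a n * (lipProd n ρ σ * b) / εn = a n / ρ n / w n * (b / τ) := by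
          rw [hεn]
          by_cases hw0 : w n = 0
          · simp [hw0]
          · field_simp
        rw [h2]
        exact mul_le_mul_of_nonneg_left (hΛ n hnL) (by positivity)
      rcases Nat.eq_zero_or_pos (𝒜 c).card with h | h
      · rw [h]; simpa using (Real.exp_pos _).le
      · exact (Real.log_le_iff_le_exp (by exact_mod_cast h)).1 h1
    refine ⟨C.attach.biUnion fun c => (𝒜 c).image fun A i =>
      act n (Matrix.toEuclideanLin A (c.1 i)), ?_, ?_, ?_⟩
    · intro c' hc' i
      obtain ⟨c, -, hc⟩ := Finset.mem_biUnion.1 hc'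
      obtain ⟨A, hA, rfl⟩ := Finset.mem_image.1 hc
      refine (norm_act_le (hσ n hnL) (h0 n hnL) _).trans ?_
      calc (σ n : ℝ) * ‖Matrix.toEuclideanLin A (c.1 i)‖
          ≤ σ n * (ρ n * (lipProd n ρ σ * ‖y i‖)) := by
            gcongr
            exact (norm_toEuclideanLin_le _ (h𝒜V c A hA).1 _).trans
              (mul_le_mul_of_nonneg_left (hC1 c.1 c.2 i) hρn.le)
        _ = lipProd (n + 1) ρ σ * ‖y i‖ := by rw [lipProd_succ]; ring
    · set C' := C.attach.biUnion fun c => (𝒜 c).image fun A i =>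
        act n (Matrix.toEuclideanLin A (c.1 i))
      rw [Finset.sum_range_succ]
      have hsum0 : 0 ≤ ∑ ℓ ∈ Finset.range n, 8 * (a ℓ / ρ ℓ / w ℓ * (b / τ)) ^ 2 * Λ :=
        Finset.sum_nonneg fun ℓ _ => by positivity
      rcases Nat.eq_zero_or_pos C'.card with h | h
      · rw [h]; simpa using add_nonneg hsum0 hent0
      have h1 : (C'.card : ℝ) ≤ C.card * Real.exp ent := by
        calc (C'.card : ℝ) ≤ ∑ c ∈ C.attach, ((𝒜 c).card : ℝ) := by
              exact_mod_cast Finset.card_biUnion_le.trans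
                (Finset.sum_le_sum fun c _ => Finset.card_image_le)
          _ ≤ ∑ _c ∈ C.attach, Real.exp ent := Finset.sum_le_sum fun c _ => hcard c
          _ = C.card * Real.exp ent := by simp
      have hCpos : (0 : ℝ) < C.card := by
        have h2 : (0 : ℝ) < C.card * Real.exp ent := lt_of_lt_of_le (by exact_mod_cast h) h1
        exact pos_of_mul_pos_left h2 (Real.exp_pos _).le
      have h2 := Real.log_le_log (by exact_mod_cast h) h1
      rw [Real.log_mul hCpos.ne' (Real.exp_pos _).ne', Real.log_exp] at h2
      linarith
    · intro Θ hΘ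
      obtain ⟨c, hc, hcd⟩ := hC3 Θ hΘ
      obtain ⟨A, hA, hAd⟩ := h𝒜 ⟨c, hc⟩ (Θ n) (hΘ n hnL)
      refine ⟨_, Finset.mem_biUnion.2 ⟨⟨c, hc⟩, Finset.mem_attach _ _,
        Finset.mem_image_of_mem _ hA⟩, ?_⟩
      have hW : 0 ≤ ∑ ℓ ∈ Finset.range n, w ℓ := Finset.sum_nonneg fun ℓ hℓ =>
        hw ℓ ((Finset.mem_range.1 hℓ).trans hnL)
      set Dn := τ * lipProd n ρ σ * ∑ ℓ ∈ Finset.range n, w ℓ with hDn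
      have hDn0 : 0 ≤ Dn := by positivity
      have h1 : ∑ i, ‖Matrix.toEuclideanLin (Θ n) (network act Θ n (y i) - c i)‖ ^ 2
          ≤ (ρ n * Dn) ^ 2 := by
        rw [mul_pow]
        refine le_trans ?_ (mul_le_mul_of_nonneg_left hcd (sq_nonneg _))
        rw [Finset.mul_sum]
        refine Finset.sum_le_sum fun i _ => ?_
        rw [← mul_pow]
        exact pow_le_pow_left₀ (norm_nonneg _) (norm_toEuclideanLin_le _ (hΘ n hnL).1 _) 2
      -- The error before the activation is `Θ n` applied to the old error plus the error of
      -- replacing `Θ n` by `A` at the centre.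
      have h2 := sum_norm_add_sq_le _ _ (mul_nonneg hρn.le hDn0) hεn0 h1 hAd
      calc ∑ i, ‖network act Θ (n + 1) (y i) - act n (Matrix.toEuclideanLin A (c i))‖ ^ 2
          ≤ ∑ i, (σ n : ℝ) ^ 2 * ‖Matrix.toEuclideanLin (Θ n) (network act Θ n (y i) - c i)
              + (Matrix.toEuclideanLin (Θ n) (c i) - Matrix.toEuclideanLin A (c i))‖ ^ 2 := by
            refine Finset.sum_le_sum fun i _ => ?_
            rw [← mul_pow, map_sub, sub_add_sub_cancel]
            exact pow_le_pow_left₀ (norm_nonneg _) ((hσ n hnL).norm_sub_le _ _) 2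
        _ ≤ (σ n : ℝ) ^ 2 * (ρ n * Dn + εn) ^ 2 := by
            rw [← Finset.mul_sum]
            exact mul_le_mul_of_nonneg_left h2 (sq_nonneg _)
        _ = _ := by
            rw [← mul_pow, Finset.sum_range_succ, lipProd_succ, hDn, hεn]
            ring

/-- Metric entropy of the outputs of a network class at finitely many points. -/
theorem exists_cover_network {ι : Type*} [Fintype ι]
    (hσ : ∀ ℓ < L, LipschitzWith (σ ℓ) (act ℓ)) (hσ0 : ∀ ℓ < L, 0 < σ ℓ)
    (h0 : ∀ ℓ < L, act ℓ 0 = 0) (hρ : ∀ ℓ < L, 0 < ρ ℓ) (ha : ∀ ℓ < L, 0 ≤ a ℓ)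
    (y : ι → Euc (width 0)) {b ε Λ : ℝ} (hb : 0 ≤ b) (hy : ∑ i, ‖y i‖ ^ 2 ≤ b ^ 2) (hε : 0 < ε)
    (hΛ : ∀ ℓ < L, Real.log (2 * (width (ℓ + 1) * Fintype.card ι) + 1) ≤ Λ) :
    ∃ C : Finset (ι → Euc (width L)), (∀ c ∈ C, ∀ i, ‖c i‖ ≤ lipProd L ρ σ * ‖y i‖) ∧
      Real.log C.card ≤ 8 * (b * lipProd L ρ σ) ^ 2 *
        (∑ ℓ ∈ Finset.range L, (a ℓ / ρ ℓ) ^ (2 / 3 : ℝ)) ^ 3 * Λ / ε ^ 2 ∧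
      ∀ Θ ∈ weightSet L ρ a Θ₀, ∃ c ∈ C,
        ∑ i, ‖network act Θ L (y i) - c i‖ ^ 2 ≤ ε ^ 2 := by
  set S := ∑ ℓ ∈ Finset.range L, (a ℓ / ρ ℓ) ^ (2 / 3 : ℝ) with hS
  have hα : ∀ ℓ < L, 0 ≤ a ℓ / ρ ℓ := fun ℓ hℓ => div_nonneg (ha ℓ hℓ) (hρ ℓ hℓ).le
  have hα' : ∀ ℓ < L, 0 ≤ (a ℓ / ρ ℓ) ^ (2 / 3 : ℝ) := fun ℓ hℓ => Real.rpow_nonneg (hα ℓ hℓ) _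
  have hS0 : 0 ≤ S := Finset.sum_nonneg fun ℓ hℓ => hα' ℓ (Finset.mem_range.1 hℓ)
  have hSz : ∀ ℓ < L, (a ℓ / ρ ℓ) ^ (2 / 3 : ℝ) / S = 0 → a ℓ / ρ ℓ = 0 := by
    intro ℓ hℓ h
    have h1 : (a ℓ / ρ ℓ) ^ (2 / 3 : ℝ) = 0 := by
      rcases div_eq_zero_iff.1 h with h | h
      · exact h
      · exact (Finset.sum_eq_zero_iff_of_nonneg fun ℓ hℓ => hα' ℓ (Finset.mem_range.1 hℓ)).1 h ℓ
          (Finset.mem_range.2 hℓ)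
    exact (Real.rpow_eq_zero (hα ℓ hℓ) (by norm_num)).1 h1
  have hP : 0 < lipProd L ρ σ := Finset.prod_pos fun ℓ hℓ =>
    mul_pos (hρ ℓ (Finset.mem_range.1 hℓ)) (hσ0 ℓ (Finset.mem_range.1 hℓ))
  -- With `α = a/ρ`, these weights minimize `∑ α² / w²` under `∑ w = 1`: each term becomes `α^(2/3)
  -- S²`, in total `S³`. If `S = 0`, every `a ℓ` is zero and so are the weights.
  obtain ⟨C, hC1, hC2, hC3⟩ := exists_cover_network_of_weights (Θ₀ := Θ₀) hσ hσ0 h0 hρ ha y hb hy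
    (div_pos hε hP) hΛ (fun ℓ => (a ℓ / ρ ℓ) ^ (2 / 3 : ℝ) / S)
    (fun ℓ hℓ => div_nonneg (hα' ℓ hℓ) hS0)
    (fun ℓ hℓ h => (div_eq_zero_iff.1 (hSz ℓ hℓ h)).resolve_right (hρ ℓ hℓ).ne') le_rfl
  refine ⟨C, hC1, hC2.trans (le_of_eq ?_), fun Θ hΘ => ?_⟩
  · have h1 : ∀ ℓ ∈ Finset.range L,
        8 * (a ℓ / ρ ℓ / ((a ℓ / ρ ℓ) ^ (2 / 3 : ℝ) / S) * (b / (ε / lipProd L ρ σ))) ^ 2 * Λ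
        = (a ℓ / ρ ℓ) ^ (2 / 3 : ℝ) * (8 * (b * lipProd L ρ σ) ^ 2 * S ^ 2 * Λ / ε ^ 2) := by
      intro ℓ hℓ
      have hℓ' := Finset.mem_range.1 hℓ
      by_cases hz : a ℓ / ρ ℓ = 0
      · rw [hz, Real.zero_rpow (by norm_num)]; simp
      have hpos : 0 < a ℓ / ρ ℓ := (hα ℓ hℓ').lt_of_ne (Ne.symm hz)
      have hSpos : S ≠ 0 := fun h => hz (hSz ℓ hℓ' (by rw [h, div_zero]))
      set α := a ℓ / ρ ℓ
      set β := α ^ (2 / 3 : ℝ) with hβ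
      have hβpos : 0 < β := Real.rpow_pos_of_pos hpos _
      have hcube : α ^ 2 = β ^ 3 := by
        rw [hβ, ← Real.rpow_natCast, ← Real.rpow_natCast, ← Real.rpow_mul hpos.le]
        norm_num
      have h2 : α / (β / S) * (b / (ε / lipProd L ρ σ)) = α / β * (S * b * lipProd L ρ σ / ε) := by
        field_simp
      rw [h2, mul_pow, div_pow, hcube]
      field_simp
    rw [Finset.sum_congr rfl h1, ← Finset.sum_mul, ← hS]
    ring
  · obtain ⟨c, hc, h⟩ := hC3 Θ hΘ
    refine ⟨c, hc, h.trans ?_⟩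
    rw [div_mul_cancel₀ _ hP.ne', ← Finset.sum_div, ← hS]
    refine pow_le_pow_left₀ (mul_nonneg hε.le (div_nonneg hS0 hS0)) ?_ 2
    exact mul_le_of_le_one_right hε.le (div_self_le_one S)

end Network

/-! ### Lipschitz and size bounds for the KL regularizer -/

section Regularizer

variable {m d : ℕ}

theorem norm_meanPart_le (h : m = 2 * d) (v : Euc m) : ‖meanPart h v‖ ≤ ‖v‖ := by
  subst h
  refine (abs_le_of_sq_le_sq' ?_ (norm_nonneg _)).2
  rw [EuclideanSpace.norm_sq_eq, EuclideanSpace.norm_sq_eq]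
  have hinj : Function.Injective fun j : Fin d => (⟨j, by omega⟩ : Fin (2 * d)) := fun i j hij => by
    simpa [Fin.ext_iff] using hij
  refine le_trans (le_of_eq (Finset.sum_image (f := fun i : Fin (2 * d) => ‖v i‖ ^ 2)
    (g := fun j : Fin d => (⟨j, by omega⟩ : Fin (2 * d))) (s := Finset.univ) hinj.injOn).symm) ?_
  exact Finset.sum_le_sum_of_subset_of_nonneg (Finset.subset_univ _) fun _ _ _ => sq_nonneg _

theorem meanPart_sub (h : m = 2 * d) (u v : Euc m) :
    meanPart h (u - v) = meanPart h u - meanPart h v := rfl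

theorem abs_logVarPart_le (h : m = 2 * d) (v : Euc m) (j : Fin d) : |logVarPart h v j| ≤ ‖v‖ := by
  have := PiLp.norm_apply_le v ⟨d + j, by omega⟩
  exact this

theorem abs_exp_sub_exp_le {s t R : ℝ} (hs : s ≤ R) (ht : t ≤ R) :
    |Real.exp s - Real.exp t| ≤ Real.exp R * |s - t| := by
  wlog hst : t ≤ s generalizing s t
  · rw [abs_sub_comm, abs_sub_comm s]
    exact this ht hs (not_le.1 hst).le
  rw [abs_of_nonneg (sub_nonneg.2 (Real.exp_le_exp.2 hst)), abs_of_nonneg (sub_nonneg.2 hst)]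
  have h1 := Real.add_one_le_exp (t - s)
  have h2 : Real.exp t = Real.exp s * Real.exp (t - s) := by rw [← Real.exp_add]; simp
  have h3 := Real.exp_le_exp.2 hs
  have h4 := Real.exp_pos s
  calc Real.exp s - Real.exp t = Real.exp s * (1 - Real.exp (t - s)) := by rw [h2]; ring
    _ ≤ Real.exp s * (s - t) := mul_le_mul_of_nonneg_left (by linarith) h4.le
    _ ≤ Real.exp R * (s - t) := mul_le_mul_of_nonneg_right h3 (sub_nonneg.2 hst)

/-- The KL regularizer is Lipschitz on balls. -/
theorem abs_klReg_sub_le (h : m = 2 * d) (hd : 1 ≤ d) {u v : Euc m} {R : ℝ} (hu : ‖u‖ ≤ R)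
    (hv : ‖v‖ ≤ R) : |klReg h u - klReg h v| ≤ 2 * Real.exp R * ‖u - v‖ := by
  have hd0 : (1 : ℝ) ≤ d := by exact_mod_cast hd
  have hR : 0 ≤ R := (norm_nonneg _).trans hu
  have hsub : ∀ j, logVarPart h u j - logVarPart h v j = logVarPart h (u - v) j := fun _ => rfl
  have h1 : |‖meanPart h u‖ ^ 2 - ‖meanPart h v‖ ^ 2| ≤ 2 * R * ‖u - v‖ := by
    rw [sq_sub_sq, abs_mul]
    refine mul_le_mul ?_ ((abs_norm_sub_norm_le _ _).trans ?_) (abs_nonneg _) (by positivity)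
    · rw [abs_of_nonneg (by positivity)]
      linarith [norm_meanPart_le h u, norm_meanPart_le h v]
    · rw [← meanPart_sub]
      exact norm_meanPart_le h _
  have h2 : |(∑ j : Fin d, |Real.exp (logVarPart h u j)|)
      - (∑ j : Fin d, |Real.exp (logVarPart h v j)|)| ≤ d * (Real.exp R * ‖u - v‖) := by
    rw [← Finset.sum_sub_distrib]
    refine abs_sum_fin_le fun j => ?_
    rw [abs_of_pos (Real.exp_pos _), abs_of_pos (Real.exp_pos _)]
    refine (abs_exp_sub_exp_le (R := R) ?_ ?_).trans ?_
    · exact (le_abs_self _).trans ((abs_logVarPart_le h u j).trans hu)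
    · exact (le_abs_self _).trans ((abs_logVarPart_le h v j).trans hv)
    · rw [hsub]
      exact mul_le_mul_of_nonneg_left (abs_logVarPart_le h _ j) (Real.exp_pos _).le
  have h3 : |(∑ j : Fin d, logVarPart h u j) - ∑ j : Fin d, logVarPart h v j| ≤ d * ‖u - v‖ := by
    rw [← Finset.sum_sub_distrib]
    exact abs_sum_fin_le fun j => by rw [hsub]; exact abs_logVarPart_le h _ j
  have h4 : klReg h u - klReg h v = 1 / (2 * (d : ℝ)) *
      ((‖meanPart h u‖ ^ 2 - ‖meanPart h v‖ ^ 2)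
        + ((∑ j : Fin d, |Real.exp (logVarPart h u j)|) - (∑ j : Fin d, |Real.exp (logVarPart h v j)|))
        - ((∑ j : Fin d, logVarPart h u j) - ∑ j : Fin d, logVarPart h v j)) := by
    unfold klReg
    ring
  rw [h4, abs_mul, abs_of_pos (by positivity : 0 < 1 / (2 * (d : ℝ))), one_div,
    inv_mul_le_iff₀ (by positivity)]
  refine (abs_sub _ _).trans ((add_le_add ((abs_add_le _ _).trans (add_le_add h1 h2)) h3).trans ?_)
  have h5 := Real.add_one_le_exp R
  have h6 : 2 * R ≤ d * (2 * R) := by nlinarith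
  -- The three summands contribute `2 R`, `d exp R` and `d`; `R + 1 ≤ exp R` and the prefactor `1 /
  -- (2 d)` leave a constant free of `d`.
  have h7 : 2 * R + d * Real.exp R + d ≤ 2 * d * (2 * Real.exp R) := by nlinarith
  have := mul_le_mul_of_nonneg_right h7 (norm_nonneg (u - v))
  linarith

theorem klReg_zero (h : m = 2 * d) : klReg h 0 = 0 := by
  have h1 : meanPart h 0 = 0 := rfl
  have h2 : ∀ j, logVarPart h (0 : Euc m) j = 0 := fun _ => rfl
  simp [klReg, h1, h2]

/-- Comparison with the value `0` at the origin. The factor `R` lets the confidence term scale with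
`R` like the complexity term. -/
theorem abs_klReg_le (h : m = 2 * d) (hd : 1 ≤ d) {v : Euc m} {R : ℝ} (hv : ‖v‖ ≤ R) :
    |klReg h v| ≤ 2 * Real.exp R * R := by
  have h1 := abs_klReg_sub_le h hd hv (v := 0) (by simpa using (norm_nonneg _).trans hv)
  rw [klReg_zero, sub_zero, sub_zero] at h1
  exact h1.trans (mul_le_mul_of_nonneg_left hv (by positivity))

theorem continuous_klReg (h : m = 2 * d) : Continuous (klReg h) := by
  have h1 : Continuous fun v : Euc m => meanPart h v := by unfold meanPart; fun_prop
  have h2 : ∀ j, Continuous fun v : Euc m => logVarPart h v j := fun j => by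
    unfold logVarPart; fun_prop
  unfold klReg
  fun_prop

end Regularizer

/-! ### Uniform deviation bounds -/

theorem abs_ciSup_sub_ciSup_le {κ : Type*} [Finite κ] [Nonempty κ] {f g : κ → ℝ} {c : ℝ}
    (h : ∀ k, |f k - g k| ≤ c) : |(⨆ k, f k) - ⨆ k, g k| ≤ c := by
  have key : ∀ f g : κ → ℝ, (∀ k, |f k - g k| ≤ c) → (⨆ k, f k) ≤ (⨆ k, g k) + c :=
    fun f g h => ciSup_le fun k => by linarith [(abs_le.1 (h k)).2, le_ciSup_finite g k]
  have h1 := key f g h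
  have h2 := key g f fun k => by rw [abs_sub_comm]; exact h k
  exact abs_le.2 ⟨by linarith, by linarith⟩

/-- Uniform deviation bound over a finite class: the one-sided deviation exceeds twice the
Rademacher complexity by at most a bounded-differences term. -/
theorem measureReal_finite_class_deviation_le {Z κ : Type*} [MeasurableSpace Z] (μ : Measure Z)
    [IsProbabilityMeasure μ] [Finite κ] [Nonempty κ] {n : ℕ} (hn : 1 ≤ n) (g : κ → Z → ℝ)
    (hg : ∀ k, Measurable (g k)) {M R δ : ℝ} (hM0 : 0 < M) (hM : ∀ k z, |g k z| ≤ M)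
    (hR : ∀ z : Fin n → Z, rademacher (fun k i => g k (z i)) ≤ R) (hδ : 0 < δ) (hδ1 : δ < 1) :
    1 - δ ≤ (Measure.pi fun _ : Fin n => μ).real
      {z | ∀ k, ∑ i, ((∫ y, g k y ∂μ) - g k (z i))
        ≤ 2 * R + 2 * M * Real.sqrt (n * Real.log (1 / δ) / 2)} := by
  have hgk : ∀ k, |∫ y, g k y ∂μ| ≤ M := fun k => by
    simpa using norm_integral_le_of_norm_le_const (μ := μ) (f := g k) (C := M)
      (Filter.Eventually.of_forall (hM k))
  have hm : Measurable fun z : Fin n → Z => ⨆ k, ∑ i, ((∫ y, g k y ∂μ) - g k (z i)) :=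
    Measurable.iSup fun k => Finset.measurable_sum _ fun i _ =>
      measurable_const.sub ((hg k).comp (measurable_pi_apply i))
  have h1 := measureReal_le_add_of_bounded_differences μ (c := 2 * M) (K := n * (2 * M))
    (by positivity) hδ hδ1 hn _ hm
    (fun z => abs_ciSup_le fun k => abs_sum_fin_le fun i =>
      (abs_sub _ _).trans (by linarith [hM k (z i), hgk k]))
    (fun z j w => abs_ciSup_sub_ciSup_le fun k => by
      rw [← Finset.sum_sub_distrib, Finset.sum_eq_single j]
      · rw [Function.update_self, sub_sub_sub_cancel_left]
        exact (abs_sub _ _).trans (by linarith [hM k (z j), hM k w])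
      · intro i _ hij
        rw [Function.update_of_ne hij, sub_self]
      · simp)
  refine h1.trans (measureReal_mono fun z hz k => ?_)
  have h2 := integral_iSup_deviation_le μ g hg hM hR
  have h3 := le_ciSup_finite (fun k => ∑ i, ((∫ y, g k y ∂μ) - g k (z i))) k
  have h4 : (⨆ k, ∑ i, ((∫ y, g k y ∂μ) - g k (z i))) ≤ _ := hz
  linarith

/-- Uniform deviation bound over a separable class. -/
theorem exists_measurableSet_deviation_le {Z S : Type*} [MeasurableSpace Z] (μ : Measure Z)
    [IsProbabilityMeasure μ] [TopologicalSpace S] [FirstCountableTopology S]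
    [TopologicalSpace.SeparableSpace S]
    [Nonempty S] {n : ℕ} (hn : 1 ≤ n) (g : S → Z → ℝ) (hg : ∀ θ, Measurable (g θ))
    (hgc : ∀ z, Continuous fun θ => g θ z) {M R δ : ℝ} (hM0 : 0 < M) (hM : ∀ θ z, |g θ z| ≤ M)
    (hR : ∀ (m : ℕ) (θ : Fin (m + 1) → S) (z : Fin n → Z),
      rademacher (fun k i => g (θ k) (z i)) ≤ R) (hδ : 0 < δ) (hδ1 : δ < 1) :
    ∃ G : Set (Fin n → Z), MeasurableSet G ∧ 1 - δ ≤ (Measure.pi fun _ : Fin n => μ).real G ∧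
      ∀ z ∈ G, ∀ θ, ∑ i, ((∫ y, g θ y ∂μ) - g θ (z i))
        ≤ 2 * R + 2 * M * Real.sqrt (n * Real.log (1 / δ) / 2) := by
  set t := 2 * R + 2 * M * Real.sqrt (n * Real.log (1 / δ) / 2)
  set u := TopologicalSpace.denseSeq S
  -- The events for initial segments of a dense sequence decrease and each has probability at least
  -- `1 - δ`, hence so has their intersection: no union bound is paid.
  set G : ℕ → Set (Fin n → Z) := fun m =>
    {z | ∀ k : Fin (m + 1), ∑ i, ((∫ y, g (u k) y ∂μ) - g (u k) (z i)) ≤ t} with hG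
  have hGm : ∀ m, MeasurableSet (G m) := fun m => by
    rw [hG]
    simp only [Set.ofPred_forall]
    exact MeasurableSet.iInter fun k => measurableSet_le (Finset.measurable_sum _ fun i _ =>
      measurable_const.sub ((hg _).comp (measurable_pi_apply i))) measurable_const
  have hanti : Antitone G := fun m m' hmm z hz k =>
    hz ⟨k, lt_of_lt_of_le k.2 (by omega)⟩
  refine ⟨⋂ m, G m, MeasurableSet.iInter hGm, ?_, fun z hz θ => ?_⟩
  · have h1 := tendsto_measure_iInter_atTop (μ := Measure.pi fun _ : Fin n => μ)
      (fun m => (hGm m).nullMeasurableSet) hanti ⟨0, measure_ne_top _ _⟩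
    have h2 := (ENNReal.tendsto_toReal (measure_ne_top _ _)).comp h1
    refine ge_of_tendsto h2 (Filter.Eventually.of_forall fun m => ?_)
    exact measureReal_finite_class_deviation_le μ hn (fun k : Fin (m + 1) => g (u k))
      (fun k => hg _) hM0 (fun k => hM _) (hR m fun k => u k) hδ hδ1
  · have hint : Continuous fun θ => ∫ y, g θ y ∂μ :=
      continuous_of_dominated (bound := fun _ => M) (fun θ => (hg θ).aestronglyMeasurable)
        (fun θ => Filter.Eventually.of_forall (hM θ)) (integrable_const _)
        (Filter.Eventually.of_forall hgc)
    have hcl : IsClosed {θ | ∑ i, ((∫ y, g θ y ∂μ) - g θ (z i)) ≤ t} :=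
      isClosed_le (continuous_finsetSum _ fun i _ => hint.sub (hgc _)) continuous_const
    refine (TopologicalSpace.denseRange_denseSeq S).induction_on θ hcl fun m => ?_
    exact Set.mem_iInter.1 hz m ⟨m, Nat.lt_succ_self m⟩

/-! ### Rademacher complexity of the regularized networks -/

/-- Second countability, unlike separability, passes to every subspace; so the weight set has a
dense sequence. -/
theorem secondCountableTopology_weights (width : ℕ → ℕ) :
    SecondCountableTopology (Weights width) :=
  inferInstanceAs (SecondCountableTopology
    ((ℓ : ℕ) → Fin (width (ℓ + 1)) → Fin (width ℓ) → ℝ))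

section Network

variable {L : ℕ} {width : ℕ → ℕ} {act : Activations width} {σ : ℕ → ℝ≥0} {ρ a : ℕ → ℝ}
  {Θ₀ : Weights width}

theorem continuous_network (hact : ∀ ℓ < L, Continuous (act ℓ)) {n : ℕ} (hn : n ≤ L) :
    Continuous fun p : Weights width × Euc (width 0) => network act p.1 n p.2 := by
  induction n with
  | zero => exact continuous_snd
  | succ n ih =>
    refine (hact n hn).comp ?_
    simp only [Matrix.toLpLin_apply]
    refine (PiLp.continuous_toLp 2 _).comp (Continuous.matrix_mulVec ?_ ?_)
    · exact (continuous_apply n).comp continuous_fst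
    · exact (PiLp.continuous_ofLp 2 _).comp (ih (by omega))

/-- For `W ≥ 2` the count is at most `W⁴ N`, and `4 log W ≥ 1` turns the sum of logarithms into a
product. -/
theorem log_card_le {q N W : ℕ} (hN : 1 ≤ N) (hW : 2 ≤ W) (hq : q ≤ W) :
    Real.log (2 * (q * (2 * N)) + 1) ≤ 4 * Real.log W * (1 + Real.log N) := by
  have hN' : (1 : ℝ) ≤ N := by exact_mod_cast hN
  have hW' : (2 : ℝ) ≤ W := by exact_mod_cast hW
  have hq' : (q : ℝ) ≤ W := by exact_mod_cast hq
  have hq0 : (0 : ℝ) ≤ q := Nat.cast_nonneg q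
  have h1 : (2 * (q * (2 * N)) + 1 : ℝ) ≤ W ^ 4 * N := by
    have h2 : (W : ℝ) ^ 4 = W * W ^ 3 := by ring
    have h3 : (8 : ℝ) ≤ W ^ 3 := by
      calc (8 : ℝ) = 2 ^ 3 := by norm_num
        _ ≤ W ^ 3 := pow_le_pow_left₀ (by norm_num) hW' 3
    have h4 : (q : ℝ) * N ≤ W * N := by gcongr
    have h5 : (2 : ℝ) * 1 ≤ W * N := by gcongr
    have h6 : (W : ℝ) * N * 8 ≤ W * N * W ^ 3 := by gcongr
    rw [h2]
    nlinarith
  have h2 := Real.log_le_log (by positivity) h1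
  rw [Real.log_mul (by positivity) (by positivity), Real.log_pow] at h2
  have h3 : Real.log 2 ≤ Real.log W := Real.log_le_log two_pos hW'
  have h4 := Real.log_two_gt_d9
  have h5 := Real.log_nonneg hN'
  push_cast at h2
  nlinarith

/-- Rademacher complexity of the KL regularizer over a finite set of networks. -/
theorem rademacher_klReg_le {d N : ℕ} (hd : 1 ≤ d) (hN : 1 ≤ N) (hwidth : width L = 2 * d)
    (hσ : ∀ ℓ < L, LipschitzWith (σ ℓ) (act ℓ)) (hσ0 : ∀ ℓ < L, 0 < σ ℓ)
    (h0 : ∀ ℓ < L, act ℓ 0 = 0) (hρ : ∀ ℓ < L, 0 < ρ ℓ) (ha : ∀ ℓ < L, 0 ≤ a ℓ)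
    {B Λ : ℝ} (hB : 0 ≤ B) (y' y'' : Fin N → Euc (width 0)) (hy' : ∀ i, ‖y' i‖ ≤ B)
    (hy'' : ∀ i, ‖y'' i‖ ≤ B) (hΛ0 : 0 ≤ Λ)
    (hΛ : ∀ ℓ < L, Real.log (2 * (width (ℓ + 1) * (2 * N)) + 1) ≤ Λ)
    {κ : Type*} [Finite κ] [Nonempty κ] (Θ : κ → Weights width)
    (hΘ : ∀ k, Θ k ∈ weightSet L ρ a Θ₀) :
    rademacher (fun k i => (klReg hwidth (network act (Θ k) L (y' i))
        + klReg hwidth (network act (Θ k) L (y'' i))) / 2)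
      ≤ 12 * (8 * Real.exp (B * lipProd L ρ σ) * (B * lipProd L ρ σ) * Real.sqrt N *
        Real.sqrt ((∑ ℓ ∈ Finset.range L, (a ℓ / ρ ℓ) ^ (2 / 3 : ℝ)) ^ 3 * Λ))
        * (1 + Real.log N) := by
  set S := ∑ ℓ ∈ Finset.range L, (a ℓ / ρ ℓ) ^ (2 / 3 : ℝ) with hS
  have hS0 : 0 ≤ S := Finset.sum_nonneg fun ℓ hℓ => Real.rpow_nonneg
    (div_nonneg (ha ℓ (Finset.mem_range.1 hℓ)) (hρ ℓ (Finset.mem_range.1 hℓ)).le) _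
  have hP := lipProd_nonneg le_rfl hρ σ
  set R := B * lipProd L ρ σ with hR
  have hR0 : 0 ≤ R := mul_nonneg hB hP
  have hN0 : (1 : ℝ) ≤ N := by exact_mod_cast hN
  have hlogN := Real.log_nonneg hN0
  -- `A² / ε²` is the network entropy for `2 N` points of norm at most `B` at resolution `ε / (2 exp
  -- R)`: `8 * 2 * 2² = 64 = 8²`.
  set A := 8 * Real.exp R * R * Real.sqrt N * Real.sqrt (S ^ 3 * Λ) with hA
  have hA0 : 0 ≤ A := by positivity
  have hAsq : A ^ 2 = 64 * Real.exp R ^ 2 * R ^ 2 * N * (S ^ 3 * Λ) := by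
    rw [hA, mul_pow, mul_pow, Real.sq_sqrt (by positivity), Real.sq_sqrt (by positivity)]
    ring
  set y : Fin N ⊕ Fin N → Euc (width 0) := Sum.elim y' y'' with hy
  have hyB : ∀ i, ‖y i‖ ≤ B := by rintro (i | i); exacts [hy' i, hy'' i]
  have hb : ∑ i, ‖y i‖ ^ 2 ≤ (Real.sqrt (2 * N) * B) ^ 2 := by
    calc ∑ i, ‖y i‖ ^ 2 ≤ ∑ _i : Fin N ⊕ Fin N, B ^ 2 :=
          Finset.sum_le_sum fun i _ => pow_le_pow_left₀ (norm_nonneg _) (hyB i) 2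
      _ = (Real.sqrt (2 * N) * B) ^ 2 := by
          rw [mul_pow, Real.sq_sqrt (by positivity)]
          rw [Finset.sum_const, Finset.card_univ, Fintype.card_sum, Fintype.card_fin, nsmul_eq_mul]
          push_cast
          ring
  have hLip : ∀ u v : Euc (width L), ‖u‖ ≤ R → ‖v‖ ≤ R →
      (klReg hwidth u - klReg hwidth v) ^ 2 ≤ (2 * Real.exp R) ^ 2 * ‖u - v‖ ^ 2 := by
    intro u v hu hv
    rw [← mul_pow, ← sq_abs]
    exact pow_le_pow_left₀ (abs_nonneg _) (abs_klReg_sub_le hwidth hd hu hv) 2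
  have hnet : ∀ k i, ‖network act (Θ k) L (y i)‖ ≤ R := fun k i =>
    (norm_network_le hσ h0 (hΘ k) _ le_rfl).trans (by
      rw [hR, mul_comm]; exact mul_le_mul_of_nonneg_right (hyB i) hP)
  -- Chaining needs a positive constant, but `A` may vanish; hence the detour through all `A' > A`.
  have key : ∀ A' > A, rademacher (fun k i => (klReg hwidth (network act (Θ k) L (y' i))
      + klReg hwidth (network act (Θ k) L (y'' i))) / 2) ≤ 12 * A' * (1 + Real.log N) := by
    intro A' hA'
    classical
    refine rademacher_le_of_entropy hN _ (hA0.trans_lt hA') fun ε hε => ?_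
    obtain ⟨C, hC1, hC2, hC3⟩ := exists_cover_network (Θ₀ := Θ₀) hσ hσ0 h0 hρ ha y
      (b := Real.sqrt (2 * N) * B) (ε := ε / (2 * Real.exp R)) (Λ := Λ) (by positivity) hb
      (by positivity) (fun ℓ hℓ => by
        simpa [Fintype.card_sum, two_mul] using hΛ ℓ hℓ)
    rw [← hS] at hC2
    refine ⟨C.image fun c i => (klReg hwidth (c (Sum.inl i)) + klReg hwidth (c (Sum.inr i))) / 2,
      ?_, fun k => ?_⟩
    · obtain ⟨c₀, hc₀, -⟩ := hC3 _ (hΘ (Classical.arbitrary κ))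
      have h1 : Real.log ((C.image fun (c : Fin N ⊕ Fin N → Euc (width L)) (i : Fin N) =>
          (klReg hwidth (c (Sum.inl i)) + klReg hwidth (c (Sum.inr i))) / 2).card : ℝ)
          ≤ Real.log C.card :=
        Real.log_le_log
          (by exact_mod_cast Finset.card_pos.2 ⟨_, Finset.mem_image_of_mem _ hc₀⟩)
          (by exact_mod_cast Finset.card_image_le)
      refine h1.trans (hC2.trans ?_)
      have h2 : 8 * (Real.sqrt (2 * N) * B * lipProd L ρ σ) ^ 2 * S ^ 3 * Λ
          / (ε / (2 * Real.exp R)) ^ 2 = A ^ 2 / ε ^ 2 := by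
        rw [hAsq, mul_assoc (Real.sqrt _), mul_pow, Real.sq_sqrt (by positivity), ← hR]
        field_simp
        ring
      rw [h2]
      gcongr
    · obtain ⟨c, hc, hcd⟩ := hC3 _ (hΘ k)
      refine ⟨_, Finset.mem_image_of_mem _ hc, ?_⟩
      have hcR : ∀ i, ‖c i‖ ≤ R := fun i => (hC1 c hc i).trans (by
        rw [hR, mul_comm]; exact mul_le_mul_of_nonneg_right (hyB i) hP)
      have hpt : ∀ i, (klReg hwidth (network act (Θ k) L (y i)) - klReg hwidth (c i)) ^ 2
          ≤ (2 * Real.exp R) ^ 2 * ‖network act (Θ k) L (y i) - c i‖ ^ 2 := fun i =>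
        hLip _ _ (hnet k i) (hcR i)
      have htot : ∑ i, (klReg hwidth (network act (Θ k) L (y i)) - klReg hwidth (c i)) ^ 2
          ≤ ε ^ 2 := by
        refine (Finset.sum_le_sum fun i _ => hpt i).trans ?_
        rw [← Finset.mul_sum]
        refine (mul_le_mul_of_nonneg_left hcd (sq_nonneg _)).trans (le_of_eq ?_)
        rw [← mul_pow, mul_div_cancel₀ _ (by positivity)]
      rw [Fintype.sum_sum_type, ← Finset.sum_add_distrib] at htot
      refine (Finset.sum_le_sum fun i _ => ?_).trans htot
      simp only [hy, Sum.elim_inl, Sum.elim_inr]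
      nlinarith [sq_nonneg (klReg hwidth (network act (Θ k) L (y' i)) - klReg hwidth (c (Sum.inl i))
          - (klReg hwidth (network act (Θ k) L (y'' i)) - klReg hwidth (c (Sum.inr i)))),
        sq_nonneg (klReg hwidth (network act (Θ k) L (y' i)) - klReg hwidth (c (Sum.inl i))
          + (klReg hwidth (network act (Θ k) L (y'' i)) - klReg hwidth (c (Sum.inr i))))]
  have hpos : 0 < 12 * (1 + Real.log N) := by linarith
  have h1 : rademacher (fun k i => (klReg hwidth (network act (Θ k) L (y' i))
      + klReg hwidth (network act (Θ k) L (y'' i))) / 2) / (12 * (1 + Real.log N)) ≤ A := by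
    refine le_of_forall_gt_imp_ge_of_dense fun A' hA' => ?_
    rw [div_le_iff₀ hpos]
    linarith [key A' hA']
  rw [div_le_iff₀ hpos] at h1
  linarith

end Network

/-! ### The rate and the sample space of augmentations -/

/-- The two parts of the deviation bound are of the order of the rate. -/
theorem deviation_bound_le_rate {N W : ℕ} (hN : 1 ≤ N) {R S lδ : ℝ} (hR : 0 ≤ R) (hS : 0 ≤ S)
    (hlδ : 0 ≤ lδ) :
    2 * (12 * (8 * Real.exp R * R * Real.sqrt N *
        Real.sqrt (S ^ 3 * (4 * Real.log W * (1 + Real.log N)))) * (1 + Real.log N))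
      + 2 * (2 * Real.exp R * R) * Real.sqrt (N * lδ / 2)
      ≤ N * (388 * (1 + Real.log N) ^ 2 * (Real.exp R * R / Real.sqrt N *
        max (Real.sqrt (Real.log W) * S ^ (3 / 2 : ℝ)) (Real.sqrt lδ))) := by
  have hN0 : (1 : ℝ) ≤ N := by exact_mod_cast hN
  have hW : 0 ≤ Real.log W := Real.log_natCast_nonneg W
  set l := 1 + Real.log N with hl
  have hl1 : 1 ≤ l := by linarith [Real.log_nonneg hN0]
  set m := max (Real.sqrt (Real.log W) * S ^ (3 / 2 : ℝ)) (Real.sqrt lδ)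
  have hm1 : Real.sqrt (Real.log W) * S ^ (3 / 2 : ℝ) ≤ m := le_max_left _ _
  have hm2 : Real.sqrt lδ ≤ m := le_max_right _ _
  have hm0 : 0 ≤ m := (Real.sqrt_nonneg _).trans hm2
  have hll : 1 ≤ l ^ 2 := one_le_pow₀ hl1
  have hsqrt1 : Real.sqrt (S ^ 3 * (4 * Real.log W * l)) ≤ 2 * m * l := by
    have h1 : (S ^ (3 / 2 : ℝ)) ^ 2 = S ^ 3 := by
      rw [← Real.rpow_natCast, ← Real.rpow_natCast, ← Real.rpow_mul hS]
      norm_num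
    have h2 : (Real.sqrt (Real.log W) * S ^ (3 / 2 : ℝ)) ^ 2 ≤ m ^ 2 :=
      pow_le_pow_left₀ (by positivity) hm1 2
    rw [mul_pow, Real.sq_sqrt hW, h1] at h2
    refine Real.sqrt_le_iff.2 ⟨by positivity, ?_⟩
    calc S ^ 3 * (4 * Real.log W * l) = 4 * (Real.log W * S ^ 3) * l := by ring
      _ ≤ 4 * m ^ 2 * l ^ 2 := by
          gcongr
          nlinarith
      _ = (2 * m * l) ^ 2 := by ring
  have hsqrt2 : Real.sqrt (N * lδ / 2) ≤ Real.sqrt N * m := by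
    refine (Real.sqrt_le_sqrt (by linarith [mul_nonneg (Nat.cast_nonneg N) hlδ] :
      N * lδ / 2 ≤ N * lδ)).trans ?_
    rw [Real.sqrt_mul (Nat.cast_nonneg N)]
    gcongr
  have hNs : (N : ℝ) * (388 * l ^ 2 * (Real.exp R * R / Real.sqrt N * m))
      = 388 * l ^ 2 * (Real.exp R * R * Real.sqrt N * m) := by
    have h3 : (N : ℝ) / Real.sqrt N = Real.sqrt N := Real.div_sqrt
    calc _ = 388 * l ^ 2 * (Real.exp R * R * (N / Real.sqrt N) * m) := by ring
      _ = _ := by rw [h3]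
  rw [hNs]
  -- The complexity gives `2 * 12 * 8 * 2 = 384` and McDiarmid `4`. One factor `l` comes from
  -- chaining, the other from the entropy.
  calc _ ≤ 2 * (12 * (8 * Real.exp R * R * Real.sqrt N * (2 * m * l)) * l)
        + 2 * (2 * Real.exp R * R) * (Real.sqrt N * m) := by gcongr
    _ = 384 * l ^ 2 * (Real.exp R * R * Real.sqrt N * m)
        + 4 * 1 * (Real.exp R * R * Real.sqrt N * m) := by ring
    _ ≤ 384 * l ^ 2 * (Real.exp R * R * Real.sqrt N * m)
        + 4 * l ^ 2 * (Real.exp R * R * Real.sqrt N * m) := by gcongr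
    _ = 388 * l ^ 2 * (Real.exp R * R * Real.sqrt N * m) := by ring

theorem genRate_eq (L N : ℕ) (width : ℕ → ℕ) (ρ a : ℕ → ℝ) (σ : ℕ → ℝ≥0) (B δ : ℝ)
    (h : 0 ≤ B * lipProd L ρ σ) :
    genRate L N width ρ a σ B δ
      = Real.exp (B * lipProd L ρ σ) * (B * lipProd L ρ σ) / Real.sqrt N *
        max (Real.sqrt (Real.log (maxWidth L width)) *
          (∑ ℓ ∈ Finset.range L, (a ℓ / ρ ℓ) ^ (2 / 3 : ℝ)) ^ (3 / 2 : ℝ))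
        (Real.sqrt (Real.log (1 / δ))) := by
  rw [genRate, max_eq_right (Real.one_le_exp h), mul_assoc (Real.exp _)]

theorem norm_aug_le {n : ℕ} {𝒳 : Set (Euc n)} {T : Type*} {aug : T → 𝒳 → 𝒳}
    (hbdd : BddAbove (Set.range (fun p : 𝒳 × T => ‖(aug p.2 p.1 : Euc n)‖))) (t : T) (x : 𝒳) :
    ‖(aug t x : Euc n)‖ ≤ augRadius aug :=
  le_ciSup hbdd (x, t)

theorem augRadius_nonneg {n : ℕ} {𝒳 : Set (Euc n)} {T : Type*} {aug : T → 𝒳 → 𝒳} :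
    0 ≤ augRadius aug :=
  Real.iSup_nonneg fun _ => norm_nonneg _

theorem norm_network_aug_le {L : ℕ} {width : ℕ → ℕ} {act : Activations width} {σ : ℕ → ℝ≥0}
    {ρ a : ℕ → ℝ} {Θ₀ : Weights width} {𝒳 : Set (Euc (width 0))} {T : Type*} {aug : T → 𝒳 → 𝒳}
    (hσ : ∀ ℓ < L, LipschitzWith (σ ℓ) (act ℓ))
    (h0 : ∀ ℓ < L, act ℓ 0 = 0) (hρ : ∀ ℓ < L, 0 < ρ ℓ)
    (hbdd : BddAbove (Set.range (fun p : 𝒳 × T => ‖(aug p.2 p.1 : Euc (width 0))‖)))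
    {Θ : Weights width} (hΘ : Θ ∈ weightSet L ρ a Θ₀) (t : T) (x : 𝒳) :
    ‖network act Θ L (aug t x)‖ ≤ augRadius aug * lipProd L ρ σ := by
  refine (norm_network_le hσ h0 hΘ _ le_rfl).trans ?_
  rw [mul_comm]
  exact mul_le_mul_of_nonneg_right (norm_aug_le hbdd t x) (lipProd_nonneg le_rfl hρ σ)

section Augmentation

variable {L d N : ℕ} {width : ℕ → ℕ} {act : Activations width} {σ : ℕ → ℝ≥0} {ρ a : ℕ → ℝ}
  {Θ₀ : Weights width} {𝒳 : Set (Euc (width 0))} {𝒟 : Measure 𝒳} [IsProbabilityMeasure 𝒟]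
  {T : Type*} [MeasurableSpace T] {𝒯 : Measure T} [IsProbabilityMeasure 𝒯] {aug : T → 𝒳 → 𝒳}

theorem measurable_klReg_network_aug (hwidth : width L = 2 * d)
    (hσ : ∀ ℓ < L, LipschitzWith (σ ℓ) (act ℓ))
    (hmeas : Measurable (fun p : 𝒳 × T => aug p.2 p.1)) (Θ : Weights width) :
    Measurable fun p : 𝒳 × T => klReg hwidth (network act Θ L (aug p.2 p.1)) := by
  have h1 : Continuous fun x => network act Θ L x :=
    (continuous_network (fun ℓ hℓ => (hσ ℓ hℓ).continuous) le_rfl).comp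
      (continuous_const.prodMk continuous_id)
  exact ((continuous_klReg hwidth).comp h1).measurable.comp (measurable_subtype_coe.comp hmeas)

theorem integrable_klReg_network_aug (hd : 1 ≤ d) (hwidth : width L = 2 * d)
    (hσ : ∀ ℓ < L, LipschitzWith (σ ℓ) (act ℓ)) (h0 : ∀ ℓ < L, act ℓ 0 = 0)
    (hρ : ∀ ℓ < L, 0 < ρ ℓ) (hmeas : Measurable (fun p : 𝒳 × T => aug p.2 p.1))
    (hbdd : BddAbove (Set.range (fun p : 𝒳 × T => ‖(aug p.2 p.1 : Euc (width 0))‖)))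
    {Θ : Weights width} (hΘ : Θ ∈ weightSet L ρ a Θ₀) :
    Integrable (fun p : 𝒳 × T => klReg hwidth (network act Θ L (aug p.2 p.1))) (𝒟.prod 𝒯) :=
  Integrable.of_bound (measurable_klReg_network_aug hwidth hσ hmeas Θ).aestronglyMeasurable _
    (Filter.Eventually.of_forall fun p =>
      abs_klReg_le hwidth hd (norm_network_aug_le hσ h0 hρ hbdd hΘ p.2 p.1))

/-- The average regularizer over the two augmentations of a sample has the expectation of the
regularizer over a single one. -/
theorem integral_pair_average (h : 𝒳 × T → ℝ) (hh : Integrable h (𝒟.prod 𝒯)) :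
    ∫ z : 𝒳 × T × T, (h (z.1, z.2.1) + h (z.1, z.2.2)) / 2 ∂(𝒟.prod (𝒯.prod 𝒯))
      = ∫ p, h p ∂(𝒟.prod 𝒯) := by
  have h1 : MeasurePreserving (fun z : 𝒳 × T × T => (z.1, z.2.1)) (𝒟.prod (𝒯.prod 𝒯)) (𝒟.prod 𝒯) :=
    (MeasurePreserving.id 𝒟).prod measurePreserving_fst
  have h2 : MeasurePreserving (fun z : 𝒳 × T × T => (z.1, z.2.2)) (𝒟.prod (𝒯.prod 𝒯)) (𝒟.prod 𝒯) :=
    (MeasurePreserving.id 𝒟).prod measurePreserving_snd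
  have key : ∀ φ : 𝒳 × T × T → 𝒳 × T,
      MeasurePreserving φ (𝒟.prod (𝒯.prod 𝒯)) (𝒟.prod 𝒯) →
      Integrable (fun z => h (φ z)) (𝒟.prod (𝒯.prod 𝒯)) ∧
        ∫ z, h (φ z) ∂(𝒟.prod (𝒯.prod 𝒯)) = ∫ p, h p ∂(𝒟.prod 𝒯) := by
    intro φ hφ
    refine ⟨hφ.integrable_comp_of_integrable hh, ?_⟩
    conv_rhs => rw [← hφ.map_eq]
    rw [integral_map hφ.measurable.aemeasurable (by rw [hφ.map_eq]; exact hh.aestronglyMeasurable)]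
  obtain ⟨hi1, he1⟩ := key _ h1
  obtain ⟨hi2, he2⟩ := key _ h2
  rw [integral_div, integral_add hi1 hi2, he1, he2]
  ring

/-- The generalization bound on the sample space of independent triples. -/
theorem exists_measurableSet_klReg_deviation_le (hL : 1 ≤ L) (hd : 1 ≤ d) (hN : 1 ≤ N)
    (hwidth : width L = 2 * d)
    (hσ : ∀ ℓ < L, LipschitzWith (σ ℓ) (act ℓ)) (h0 : ∀ ℓ < L, act ℓ 0 = 0)
    (hρ : ∀ ℓ < L, 0 < ρ ℓ) (ha : ∀ ℓ < L, 0 ≤ a ℓ)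
    (hmeas : Measurable (fun p : 𝒳 × T => aug p.2 p.1))
    (hbdd : BddAbove (Set.range (fun p : 𝒳 × T => ‖(aug p.2 p.1 : Euc (width 0))‖)))
    {δ : ℝ} (hδ : 0 < δ) (hδ1 : δ < 1) :
    ∃ G : Set (Fin N → 𝒳 × T × T), MeasurableSet G ∧
      1 - δ ≤ (Measure.pi fun _ : Fin N => 𝒟.prod (𝒯.prod 𝒯)).real G ∧
      ∀ z ∈ G, ∀ Θ ∈ weightSet L ρ a Θ₀,
        (∫ p : 𝒳 × T, klReg hwidth (network act Θ L (aug p.2 p.1)) ∂(𝒟.prod 𝒯))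
          - 1 / (2 * (N : ℝ)) * ∑ i, (klReg hwidth (network act Θ L (aug (z i).2.1 (z i).1))
            + klReg hwidth (network act Θ L (aug (z i).2.2 (z i).1)))
        ≤ 388 * (1 + Real.log N) ^ 2 * genRate L N width ρ a σ (augRadius aug) δ := by
  have hB := augRadius_nonneg (aug := aug)
  have hP := lipProd_nonneg le_rfl hρ σ
  have hR0 : 0 ≤ augRadius aug * lipProd L ρ σ := mul_nonneg hB hP
  rw [genRate_eq _ _ _ _ _ _ _ _ hR0]
  set R := augRadius aug * lipProd L ρ σ with hR
  set S := ∑ ℓ ∈ Finset.range L, (a ℓ / ρ ℓ) ^ (2 / 3 : ℝ) with hS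
  have hS0 : 0 ≤ S := Finset.sum_nonneg fun ℓ hℓ => Real.rpow_nonneg
    (div_nonneg (ha ℓ (Finset.mem_range.1 hℓ)) (hρ ℓ (Finset.mem_range.1 hℓ)).le) _
  have hnet : ∀ Θ ∈ weightSet L ρ a Θ₀, ∀ t x, ‖network act Θ L (aug t x)‖ ≤ R :=
    fun Θ hΘ t x => norm_network_aug_le hσ h0 hρ hbdd hΘ t x
  have hlδ : 0 ≤ Real.log (1 / δ) := Real.log_nonneg (by rw [le_div_iff₀ hδ]; linarith)
  rcases (weightSet L ρ a Θ₀).eq_empty_or_nonempty with hempty | hne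
  · refine ⟨Set.univ, MeasurableSet.univ, by simp [hδ.le], fun z _ Θ hΘ => ?_⟩
    rw [hempty] at hΘ
    exact absurd hΘ (Set.notMem_empty _)
  -- If `R = 0`, all outputs at augmented points vanish and both sides are zero. If `R > 0`, every
  -- `σ ℓ` is positive, as the covering argument requires.
  rcases hR0.eq_or_lt with hRz | hRpos
  · refine ⟨Set.univ, MeasurableSet.univ, by simp [hδ.le], fun z _ Θ hΘ => ?_⟩
    have hz : ∀ t x, network act Θ L (aug t x) = 0 := fun t x => norm_le_zero_iff.1 (by
      rw [hRz]; exact hnet Θ hΘ t x)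
    simp [hz, klReg_zero, ← hRz]
  have hσ0 : ∀ ℓ < L, 0 < σ ℓ := by
    intro ℓ hℓ
    refine pos_iff_ne_zero.2 fun h => hRpos.ne' ?_
    have : lipProd L ρ σ = 0 := Finset.prod_eq_zero (Finset.mem_range.2 hℓ) (by rw [h]; simp)
    rw [hR, this, mul_zero]
  have hW : ∀ ℓ < L, width (ℓ + 1) ≤ maxWidth L width := fun ℓ hℓ =>
    Finset.le_sup (f := width) (Finset.mem_Icc.2 ⟨by omega, by omega⟩)
  have hW2 : 2 ≤ maxWidth L width := by
    have h1 : width L ≤ maxWidth L width :=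
      Finset.le_sup (f := width) (Finset.mem_Icc.2 ⟨hL, le_rfl⟩)
    omega
  have hsc := secondCountableTopology_weights width
  have := hne.to_subtype
  have hM0 : 0 < 2 * Real.exp R * R := by positivity
  set g : weightSet L ρ a Θ₀ → 𝒳 × T × T → ℝ := fun Θ z =>
    (klReg hwidth (network act Θ.1 L (aug z.2.1 z.1))
      + klReg hwidth (network act Θ.1 L (aug z.2.2 z.1))) / 2 with hg
  have hk : ∀ Θ : Weights width,
      Measurable fun p : 𝒳 × T => klReg hwidth (network act Θ L (aug p.2 p.1)) :=
    measurable_klReg_network_aug hwidth hσ hmeas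
  obtain ⟨G, hGm, hGδ, hG⟩ := exists_measurableSet_deviation_le (𝒟.prod (𝒯.prod 𝒯)) hN g
    (fun Θ => Measurable.div_const (Measurable.add
      ((hk Θ.1).comp (measurable_fst.prodMk (measurable_fst.comp measurable_snd)))
      ((hk Θ.1).comp (measurable_fst.prodMk (measurable_snd.comp measurable_snd)))) _)
    (fun z => by
      have h1 : ∀ x : Euc (width 0), Continuous fun Θ : weightSet L ρ a Θ₀ =>
          klReg hwidth (network act Θ.1 L x) := fun x =>
        (continuous_klReg hwidth).comp
          ((continuous_network (fun ℓ hℓ => (hσ ℓ hℓ).continuous) le_rfl).comp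
            (continuous_subtype_val.prodMk continuous_const))
      exact ((h1 _).add (h1 _)).div_const _)
    hM0
    (fun Θ z => by
      have h1 := abs_klReg_le hwidth hd (hnet Θ.1 Θ.2 z.2.1 z.1)
      have h2 := abs_klReg_le hwidth hd (hnet Θ.1 Θ.2 z.2.2 z.1)
      rw [hg, abs_div, abs_two, div_le_iff₀ two_pos]
      exact (abs_add_le _ _).trans (by linarith))
    (fun m Θ z => rademacher_klReg_le hd hN hwidth hσ hσ0 h0 hρ ha hB
      (fun i => (aug (z i).2.1 (z i).1 : Euc (width 0)))
      (fun i => (aug (z i).2.2 (z i).1 : Euc (width 0))) (fun i => norm_aug_le hbdd _ _)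
      (fun i => norm_aug_le hbdd _ _)
      (mul_nonneg (mul_nonneg (by norm_num) (Real.log_natCast_nonneg _))
        (by linarith [Real.log_natCast_nonneg N]))
      (fun ℓ hℓ => log_card_le hN hW2 (hW ℓ hℓ)) (fun k => (Θ k).1) fun k => (Θ k).2) hδ hδ1
  refine ⟨G, hGm, hGδ, fun z hz Θ hΘ => ?_⟩
  have h1 := (hG z hz ⟨Θ, hΘ⟩).trans (deviation_bound_le_rate hN hR0 hS0 hlδ)
  have h2 : ∫ y, g ⟨Θ, hΘ⟩ y ∂(𝒟.prod (𝒯.prod 𝒯))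
      = ∫ p : 𝒳 × T, klReg hwidth (network act Θ L (aug p.2 p.1)) ∂(𝒟.prod 𝒯) :=
    integral_pair_average (fun p : 𝒳 × T => klReg hwidth (network act Θ L (aug p.2 p.1)))
      (integrable_klReg_network_aug hd hwidth hσ h0 hρ hmeas hbdd hΘ)
  have hN0 : (0 : ℝ) < N := by exact_mod_cast hN
  rw [Finset.sum_sub_distrib, Finset.sum_const, Finset.card_univ, Fintype.card_fin, nsmul_eq_mul,
    h2, hg, ← Finset.sum_div] at h1
  refine le_of_mul_le_mul_left (le_trans (le_of_eq ?_) h1) hN0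
  field_simp

end Augmentation

end VCL

end

theorem corollary1 :
    -- `C` and `k` are absolute: the `Õ` hides a universal constant and a power of `log N`
    ∃ C : ℝ, 0 < C ∧ ∃ k : ℕ,
      ∀ (L d N : ℕ) (_ : 1 ≤ L) (_ : 1 ≤ d) (_ : 1 ≤ N)
        -- the class of encoders with values in `ℝ^(2d)`
        (width : ℕ → ℕ) (hwidth : width L = 2 * d)
        (act : VCL.Activations width) (σ : ℕ → ℝ≥0)
        (_ : ∀ ℓ < L, LipschitzWith (σ ℓ) (act ℓ)) (_ : ∀ ℓ < L, act ℓ 0 = 0)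
        (ρ a : ℕ → ℝ) (_ : ∀ ℓ < L, 0 < ρ ℓ) (_ : ∀ ℓ < L, 0 ≤ a ℓ)
        (Θ₀ : VCL.Weights width)
        -- the input space, the data law and the law of the random augmentation map
        (𝒳 : Set (VCL.Euc (width 0))) (𝒟 : Measure 𝒳) (_ : IsProbabilityMeasure 𝒟)
        (T : Type*) (_ : MeasurableSpace T) (𝒯 : Measure T) (_ : IsProbabilityMeasure 𝒯)
        (aug : T → 𝒳 → 𝒳) (_ : Measurable (fun p : 𝒳 × T => aug p.2 p.1))
        (_ : BddAbove (Set.range (fun p : 𝒳 × T => ‖(aug p.2 p.1 : VCL.Euc (width 0))‖)))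
        -- the samples: all of `x i`, `t' i`, `t'' i` are independent, `x i ∼ 𝒟`, `t' i, t'' i ∼ 𝒯`
        (Ω : Type*) (_ : MeasurableSpace Ω) (P : Measure Ω) (_ : IsProbabilityMeasure P)
        (x : Fin N → Ω → 𝒳) (t' t'' : Fin N → Ω → T)
        (_ : HasLaw (fun ω (i : Fin N) => (x i ω, t' i ω, t'' i ω))
          (Measure.pi (fun _ : Fin N => 𝒟.prod (𝒯.prod 𝒯))) P)
        (δ : ℝ) (_ : 0 < δ) (_ : δ < 1),
        (∀ f ∈ VCL.networkClass L act ρ a Θ₀,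
          Integrable (fun p : 𝒳 × T => VCL.klReg hwidth (f (aug p.2 p.1))) (𝒟.prod 𝒯)) ∧
        1 - δ ≤ P.real {ω |
          (⨆ f ∈ VCL.networkClass L act ρ a Θ₀,
            (((∫ p : 𝒳 × T, VCL.klReg hwidth (f (aug p.2 p.1)) ∂(𝒟.prod 𝒯))
              - 1 / (2 * (N : ℝ)) * ∑ i : Fin N,
                (VCL.klReg hwidth (f (aug (t' i ω) (x i ω)))
                  + VCL.klReg hwidth (f (aug (t'' i ω) (x i ω)))) : ℝ) : EReal))
          ≤ ((C * (1 + Real.log N) ^ k *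
              VCL.genRate L N width ρ a σ (VCL.augRadius aug) δ : ℝ) : EReal)} := by
  refine ⟨388, by norm_num, 2, ?_⟩
  intro L d N hL hd hN width hwidth act σ hσ h0 ρ a hρ ha Θ₀ 𝒳 𝒟 _ T _ 𝒯 _ aug hmeas hbdd
    Ω _ P _ x t' t'' hlaw δ hδ hδ1
  refine ⟨?_, ?_⟩
  · rintro f ⟨Θ, hΘ, rfl⟩
    exact VCL.integrable_klReg_network_aug hd hwidth hσ h0 hρ hmeas hbdd hΘ
  · obtain ⟨G, hGm, hGδ, hG⟩ := VCL.exists_measurableSet_klReg_deviation_le (𝒟 := 𝒟) (𝒯 := 𝒯)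
      (Θ₀ := Θ₀) hL hd hN hwidth hσ h0 hρ ha hmeas hbdd hδ hδ1
    have hP : (Measure.pi fun _ : Fin N => 𝒟.prod (𝒯.prod 𝒯)).real G
        = P.real ((fun ω (i : Fin N) => (x i ω, t' i ω, t'' i ω)) ⁻¹' G) := by
      rw [measureReal_def, measureReal_def, ← hlaw.map_eq,
        Measure.map_apply_of_aemeasurable hlaw.aemeasurable hGm]
    rw [hP] at hGδ
    -- The measurable event `G` pulls back into the event of the theorem, so the latter need not be
    -- measurable itself. In `EReal` the supremum only asks for a bound on each member, even for an
    -- empty class.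
    refine hGδ.trans (measureReal_mono fun ω hω => ?_)
    rw [Set.mem_ofPred_eq]
    refine iSup₂_le fun f hf => ?_
    obtain ⟨Θ, hΘ, rfl⟩ := hf
    exact EReal.coe_le_coe_iff.2 (hG _ hω Θ hΘ)
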